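/- Let $n\ge 1$, $m>0$ and $\omega_{\mathbf p}=\sqrt{|\mathbf p|^2+m^2}$ for $\mathbf p\in\mathbb R^n$. Use the Minkowski metric $(+,-,\dots,-)$, so that the covariant components of the on-shell momentum are $p_0=\omega_{\mathbf p}$, $p_j=-p^j$, and $p_kx^k=-\mathbf p\cdot\mathbf x$. Let $\mathscr F$ be the bosonic Fock space $\bigoplus_{k\ge0}\mathscr H_k^+$, where $\mathscr H_k^+$ is the space of symmetric functions of $k$ momenta that are square integrable with respect to $\prod_i d^n\mathbf p_i/(2\omega_{\mathbf p_i})$, and let $\mathscr D\subset\mathscr F$ be the subspace of vectors with finitely many non-zero components, all of them Schwartz functions. For $\Psi\in\mathscr D$ put $$(a(\mathbf p)\Psi)_k(\mathbf p_1,\dots,\mathbf p_k)=\frac{\sqrt{k+1}}{\sqrt{2\omega_{\mathbf p}}}\,\Psi_{k+1}(\mathbf p,\mathbf p_1,\dots,\mathbf p_k),\qquad \tilde a(\mathbf x)\Psi=(2\pi)^{-n/2}\int d^n\mathbf p\,e^{-ip_kx^k}a(\mathbf p)\Psi ,$$ and let $a^*(\mathbf p)$, $\tilde a^*(\mathbf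 x)$ be the adjoints in the sense of forms on $\mathscr D$. All integrals of products of these operators are understood in the sense of matrix elements: $T=\int d^ny\,A(y)^*B(y)$ means that $\langle\Phi,T\Psi\rangle=\int d^ny\,\langle A(y)\Phi,B(y)\Psi\rangle$, with absolutely convergent integral, for all $\Phi,\Psi\in\mathscr D$. Then the integral defining $\tilde a(\mathbf x)\Psi$ converges absolutely in $\mathscr F$ and $\mathbf x\mapsto\tilde a(\mathbf x)\Psi$ is differentiable for every $\Psi\in\mathscr D$, for each $\mu=0,\dots,n$ there is a unique linear operator $P_\mu:\mathscr D\to\mathscr F$ with $P_\mu=\int d^n\mathbf p\,p_\mu\,a^*(\mathbf p)a(\mathbf p)$, and these operators have the coordinate space representations $$P_0=\int d^n\mathbf x\,\tilde a^*(\mathbf x)\,(\tilde\omega*\tilde a)(\mathbf x),\qquad P_j=i\int d^n\mathbf x\,\tilde a^*(\mathbf x)\,\frac{\partial}{\partial x^j}\tilde a(\mathbf x)\quad(j=1,\dots,n),$$ where $$\tilde\omega(\mathbf x)=-2(2\pi)^{-\frac{n+1}2}\Big(\frac m{|\mathbf x|}\Big)^{\frac{n+1}2}K_{\frac{n+1}2}(m|\mathbf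 x|),$$ $K_\nu$ is the modified Bessel function of the second kind, and the convolution $(\tilde\omega*\tilde a)(\mathbf x)\Psi=\int d^n\mathbf y\,\tilde\omega(\mathbf x-\mathbf y)\,\tilde a(\mathbf y)\Psi$, whose kernel is singular like $|\mathbf x-\mathbf y|^{-(n+1)}$, is the Hadamard finite part: it is the limit in $\mathscr F$, as $\varepsilon\to0^+$, of the integral over $|\mathbf x-\mathbf y|>\varepsilon$ after subtraction of its divergent part, a linear combination of negative integer powers of $\varepsilon$ and $\log\varepsilon$ with coefficients in $\mathscr F$. -/

import Mathlib

open MeasureTheory Filter Topology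
open scoped SchwartzMap ENNReal

noncomputable section

namespace ScalarFock

/-! ### Kinematics -/

/-- Spatial momentum space, and also the spatial coordinate space, `ℝⁿ`; `p j` is the
contravariant component `p^j`. -/
abbrev Space (n : ℕ) := EuclideanSpace ℝ (Fin n)

/-- The relativistic energy `ω_p = √(|p|² + m²)`. -/
def energy {n : ℕ} (m : ℝ) (p : Space n) : ℝ := Real.sqrt (‖p‖ ^ 2 + m ^ 2)

/-- The covariant components `p_μ` of the on-shell momentum, with respect to the Minkowski
metric of signature `(+,-,…,-)`: `p_0 = ω_p` and `p_j = -p^j`. -/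
def covMomentum {n : ℕ} (m : ℝ) (p : Space n) : Fin (n + 1) → ℝ :=
  Fin.cons (energy m p) (fun j => -(p j))

/-- The contraction `p_k x^k` over the spatial indices (so it equals `-⟪p, x⟫`). -/
def spatialPairing {n : ℕ} (m : ℝ) (p x : Space n) : ℝ :=
  ∑ k : Fin n, covMomentum m p k.succ * x k

/-- The Lorentz-invariant measure `dⁿp / (2 ω_p)`. -/
def massShellMeasure (n : ℕ) (m : ℝ) : Measure (Space n) :=
  volume.withDensity (fun p => ENNReal.ofReal (1 / (2 * energy m p)))

/-- The measure of `k`-particle momentum space. -/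
abbrev kMeasure (n : ℕ) (m : ℝ) (k : ℕ) : Measure (Fin k → Space n) :=
  Measure.pi (fun _ => massShellMeasure n m)

instance instSigmaFiniteMassShell (n : ℕ) (m : ℝ) : SigmaFinite (massShellMeasure n m) := by
  unfold massShellMeasure
  exact SigmaFinite.withDensity_ofReal _

theorem continuous_energy {n : ℕ} (m : ℝ) : Continuous (energy m : Space n → ℝ) := by
  unfold energy
  fun_prop

theorem le_energy {n : ℕ} {m : ℝ} (p : Space n) : m ≤ energy m p :=
  Real.le_sqrt_of_sq_le (by nlinarith [sq_nonneg ‖p‖])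

theorem massShellMeasure_le {n : ℕ} {m : ℝ} (hm : 0 < m) :
    massShellMeasure n m ≤ ENNReal.ofReal (1 / (2 * m)) • volume := by
  rw [massShellMeasure, ← withDensity_const]
  refine withDensity_mono (Eventually.of_forall fun p => ?_)
  have := le_energy (m := m) p
  apply ENNReal.ofReal_le_ofReal
  gcongr

instance instTemperateMassShell (n : ℕ) (m : ℝ) [hm : Fact (0 < m)] :
    (massShellMeasure n m).HasTemperateGrowth := by
  obtain ⟨N, hN⟩ := (inferInstance : (volume : Measure (Space n)).HasTemperateGrowth)
  exact ⟨N, (hN.smul_measure ENNReal.ofReal_ne_top).mono_measure (massShellMeasure_le hm.out)⟩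

instance instTemperateK (n : ℕ) (m : ℝ) (k : ℕ) [hm : Fact (0 < m)] :
    (kMeasure n m k).HasTemperateGrowth := by
  obtain ⟨N, hN⟩ := instTemperateMassShell n m
  refine ⟨k * N, ?_⟩
  have h := Integrable.fintype_prod (ι := Fin k) (𝕜 := ℝ) (fun _ => hN)
  refine h.mono' (Measurable.aestronglyMeasurable (by fun_prop)) (Eventually.of_forall fun q => ?_)
  rw [Real.norm_of_nonneg (by positivity)]
  have : (1 + ‖q‖) ^ (-((k * N : ℕ) : ℝ)) = ∏ _i : Fin k, (1 + ‖q‖) ^ (-(N : ℝ)) := by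
    rw [Finset.prod_const, ← Real.rpow_natCast, ← Real.rpow_mul (by positivity)]
    congr 1
    simp
    ring
  rw [this]
  refine Finset.prod_le_prod (fun i _ => by positivity) (fun i _ => ?_)
  apply Real.rpow_le_rpow_of_nonpos (by positivity)
  · gcongr
    exact norm_le_pi_norm q i
  · simp

/-! ### The bosonic Fock space -/

theorem measurePreserving_perm (n : ℕ) (m : ℝ) (k : ℕ) (σ : Equiv.Perm (Fin k)) :
    MeasurePreserving (fun q : Fin k → Space n => q ∘ σ) (kMeasure n m k) (kMeasure n m k) := by
  have h := measurePreserving_piCongrLeft (fun _ : Fin k => massShellMeasure n m) σ.symm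
  convert h using 1
  funext q
  funext i
  have := Equiv.piCongrLeft_apply_apply (P := fun _ : Fin k => Space n) (e := σ.symm) q (σ i)
  simpa [MeasurableEquiv.coe_piCongrLeft] using this.symm

/-- The `k`-particle space: square integrable functions of `k` momenta, symmetric under all
permutations of the momenta. For `k = 0` this is a copy of `ℂ`. -/
def kParticleSpace (n : ℕ) (m : ℝ) (k : ℕ) : Submodule ℂ (Lp ℂ 2 (kMeasure n m k)) where
  carrier := {f | ∀ σ : Equiv.Perm (Fin k),
    Lp.compMeasurePreservingₗᵢ ℂ _ (measurePreserving_perm n m k σ) f = f}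
  zero_mem' σ := map_zero _
  add_mem' hf hg σ := by rw [map_add, hf σ, hg σ]
  smul_mem' c f hf σ := by rw [map_smul, hf σ]

instance instCompleteKParticle (n : ℕ) (m : ℝ) (k : ℕ) : CompleteSpace (kParticleSpace n m k) := by
  have : IsClosed (kParticleSpace n m k : Set (Lp ℂ 2 (kMeasure n m k))) := by
    have h : (kParticleSpace n m k : Set (Lp ℂ 2 (kMeasure n m k))) =
        ⋂ σ : Equiv.Perm (Fin k),
          {f | Lp.compMeasurePreservingₗᵢ ℂ _ (measurePreserving_perm n m k σ) f = f} := by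
      ext f
      simp [kParticleSpace]
    rw [h]
    exact isClosed_iInter fun σ => isClosed_eq (LinearIsometry.continuous _) continuous_id
  exact this.completeSpace_coe

/-- The bosonic Fock space: the Hilbert sum of the `k`-particle spaces. -/
def Fock (n : ℕ) (m : ℝ) : Type := lp (fun k : ℕ => kParticleSpace n m k) 2

instance instNormedAddCommGroupFock (n : ℕ) (m : ℝ) : NormedAddCommGroup (Fock n m) :=
  inferInstanceAs (NormedAddCommGroup (lp (fun k : ℕ => kParticleSpace n m k) 2))

instance instInnerProductSpaceFock (n : ℕ) (m : ℝ) : InnerProductSpace ℂ (Fock n m) :=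
  inferInstanceAs (InnerProductSpace ℂ (lp (fun k : ℕ => kParticleSpace n m k) 2))

instance instCompleteSpaceFock (n : ℕ) (m : ℝ) : CompleteSpace (Fock n m) :=
  inferInstanceAs (CompleteSpace (lp (fun k : ℕ => kParticleSpace n m k) 2))

/-! ### The domain of finite-particle Schwartz vectors -/

/-- Symmetric Schwartz functions of `k` momenta. -/
def symSchwartz (n k : ℕ) : Submodule ℂ 𝓢(Fin k → Space n, ℂ) where
  carrier := {f | ∀ (σ : Equiv.Perm (Fin k)) (q : Fin k → Space n), f (q ∘ σ) = f q}
  zero_mem' _ _ := rfl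
  add_mem' hf hg σ q := by simp [hf σ q, hg σ q]
  smul_mem' c f hf σ q := by simp [hf σ q]

/-- The domain of the operators: vectors with finitely many non-zero components, all of them
Schwartz functions. -/
abbrev Dom (n : ℕ) := Π₀ k : ℕ, symSchwartz n k

/-- A symmetric Schwartz function as an element of the `k`-particle space. -/
def toKParticle (n : ℕ) (m : ℝ) [Fact (0 < m)] (k : ℕ) :
    symSchwartz n k →ₗ[ℂ] kParticleSpace n m k :=
  ((SchwartzMap.toLpCLM ℂ ℂ 2 (kMeasure n m k)).toLinearMap ∘ₗ (symSchwartz n k).subtype).codRestrict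
    (kParticleSpace n m k) (by
      intro f σ
      change Lp.compMeasurePreserving _ (measurePreserving_perm n m k σ)
        ((f.1.memLp 2 (kMeasure n m k)).toLp) = (f.1.memLp 2 (kMeasure n m k)).toLp
      rw [Lp.toLp_compMeasurePreserving]
      congr 1
      funext q
      exact f.2 σ q)

/-- The inclusion of the domain into the Fock space. -/
def toFock {n : ℕ} (m : ℝ) [Fact (0 < m)] : Dom n →ₗ[ℂ] Fock n m where
  toFun Ψ := show lp (fun k : ℕ => kParticleSpace n m k) 2 from ⟨fun k => toKParticle n m k (Ψ k), by
    refine (memℓp_zero ?_).of_exponent_ge (zero_le (a := (2 : ℝ≥0∞)))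
    refine Ψ.finite_support.subset fun k hk h0 => hk ?_
    rw [h0, map_zero]⟩
  map_add' Φ Ψ := by
    refine Subtype.ext (funext fun k => ?_)
    exact map_add (toKParticle n m k) (Φ k) (Ψ k)
  map_smul' c Ψ := by
    refine Subtype.ext (funext fun k => ?_)
    exact map_smul (toKParticle n m k) c (Ψ k)

/-! ### Ladder operators with sharp momentum -/

theorem cons_temperate {n k : ℕ} (p : Space n) :
    Function.HasTemperateGrowth (fun q : Fin k → Space n => (Fin.cons p q : Fin (k + 1) → Space n)) := by
  have h : (fun q : Fin k → Space n => (Fin.cons p q : Fin (k + 1) → Space n)) =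
      fun q => (ContinuousLinearMap.pi (fun i : Fin (k + 1) =>
        Fin.cases (motive := fun _ => (Fin k → Space n) →L[ℝ] Space n) 0
          (fun j => ContinuousLinearMap.proj j) i)) q + Fin.cons p 0 := by
    funext q i
    refine Fin.cases ?_ (fun j => ?_) i <;> simp
  rw [h]
  exact (ContinuousLinearMap.hasTemperateGrowth _).add (Function.HasTemperateGrowth.const _)

theorem cons_upper {n k : ℕ} (p : Space n) : ∃ (N : ℕ) (C : ℝ), ∀ q : Fin k → Space n,
    ‖q‖ ≤ C * (1 + ‖(Fin.cons p q : Fin (k + 1) → Space n)‖) ^ N := by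
  refine ⟨1, 1, fun q => ?_⟩
  rw [pow_one, one_mul]
  refine (pi_norm_le_iff_of_nonneg (by positivity)).2 fun i => ?_
  have := norm_le_pi_norm (Fin.cons p q : Fin (k + 1) → Space n) i.succ
  rw [Fin.cons_succ] at this
  linarith

/-- The partial evaluation `f ↦ f(p, ·, …, ·)`. -/
def slice {n : ℕ} (k : ℕ) (p : Space n) : symSchwartz n (k + 1) →ₗ[ℂ] symSchwartz n k :=
  ((SchwartzMap.compCLM ℂ (cons_temperate p) (cons_upper p)).toLinearMap ∘ₗ
    (symSchwartz n (k + 1)).subtype).codRestrict (symSchwartz n k) (by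
      intro f σ q
      have h := f.2 (Equiv.Perm.decomposeFin.symm (0, σ)) (Fin.cons p q)
      have e : (Fin.cons p q : Fin (k + 1) → Space n) ∘ (Equiv.Perm.decomposeFin.symm (0, σ)) =
          Fin.cons p (q ∘ σ) := by
        funext i
        refine Fin.cases ?_ (fun j => ?_) i <;> simp
      rw [e] at h
      exact h)

/-- The covariant annihilation operator with sharp momentum,
`(a_c(p)Ψ)_k(p₁,…,p_k) = √(k+1) Ψ_{k+1}(p,p₁,…,p_k)`. Integrating it against
`conj f(p) dⁿp/(2ω_p)` yields the smeared operator `a_c(f)`. -/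
def annihilationCov {n : ℕ} (p : Space n) : Dom n →ₗ[ℂ] Dom n where
  toFun Ψ := DFinsupp.mapRange (fun k f => ((Real.sqrt (k + 1) : ℝ) : ℂ) • slice k p f)
    (fun k => by simp) (DFinsupp.comapDomain Nat.succ Nat.succ_injective Ψ)
  map_add' Φ Ψ := by
    ext k : 1
    simp [DFinsupp.mapRange_apply]
  map_smul' c Ψ := by
    ext k : 1
    simp [DFinsupp.mapRange_apply, smul_comm c]

/-- The annihilation operator `a(p) = a_c(p) / √(2 ω_p)` in non-covariant normalization, as an
operator from the domain into the Fock space. -/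
def annihilation {n : ℕ} (m : ℝ) [Fact (0 < m)] (p : Space n) : Dom n →ₗ[ℂ] Fock n m :=
  ((1 / Real.sqrt (2 * energy m p) : ℝ) : ℂ) • (toFock m ∘ₗ annihilationCov p)

/-- The integrand `e^{-i p_k x^k} a(p)Ψ` of the Fourier transform. -/
def fourierIntegrand {n : ℕ} (m : ℝ) [Fact (0 < m)] (x : Space n) (Ψ : Dom n) (p : Space n) :
    Fock n m :=
  Complex.exp (-Complex.I * (spatialPairing m p x : ℂ)) • annihilation m p Ψ

/-- The annihilation operator in coordinate space,
`ã(x) = (2π)^{-n/2} ∫ dⁿp e^{-i p_k x^k} a(p)`. -/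
def coordAnnihilation {n : ℕ} (m : ℝ) [Fact (0 < m)] (x : Space n) (Ψ : Dom n) : Fock n m :=
  (((2 * Real.pi) ^ (-(n : ℝ) / 2) : ℝ) : ℂ) • ∫ p, fourierIntegrand m x Ψ p

/-! ### Integrals of products of ladder operators -/

/-- `T = ∫ dⁿy A(y)* B(y)` for families `A`, `B` of operators from the domain into the Fock space.
As usual for operator-valued distributions, `A(y)*` is the form adjoint
`⟨Φ, A(y)* χ⟩ = ⟨A(y)Φ, χ⟩`, and the integral is understood in the sense of matrix elements between
vectors of the domain. -/
def IsOperatorIntegral {n : ℕ} {m : ℝ} [Fact (0 < m)] (T : Dom n →ₗ[ℂ] Fock n m)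
    (A B : Space n → Dom n → Fock n m) : Prop :=
  ∀ Φ Ψ : Dom n, Integrable (fun y => inner ℂ (A y Φ) (B y Ψ)) ∧
    inner ℂ (toFock m Φ) (T Ψ) = ∫ y, inner ℂ (A y Φ) (B y Ψ)

/-- `T` is the second-quantized momentum `P_μ = ∫ dⁿp p_μ a*(p) a(p)`. -/
def IsMomentumOperator {n : ℕ} {m : ℝ} [Fact (0 < m)] (μ : Fin (n + 1))
    (T : Dom n →ₗ[ℂ] Fock n m) : Prop :=
  IsOperatorIntegral T (fun p => annihilation m p)
    (fun p Ψ => (covMomentum m p μ : ℂ) • annihilation m p Ψ)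

/-! ### The kernel and the convolution -/

/-- The modified Bessel function of the second kind,
`K_ν(z) = ∫_0^∞ e^{-z cosh t} cosh(ν t) dt` for `z > 0`. -/
def besselK (ν z : ℝ) : ℝ :=
  ∫ t in Set.Ioi (0 : ℝ), Real.exp (-z * Real.cosh t) * Real.cosh (ν * t)

/-- The kernel `ω̃(x) = -2 (2π)^{-(n+1)/2} (m/|x|)^{(n+1)/2} K_{(n+1)/2}(m|x|)`, `x ≠ 0`. -/
def omegaTilde {n : ℕ} (m : ℝ) (x : Space n) : ℝ :=
  -2 * (2 * Real.pi) ^ (-((n : ℝ) + 1) / 2) * (m / ‖x‖) ^ (((n : ℝ) + 1) / 2) *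
    besselK (((n : ℝ) + 1) / 2) (m * ‖x‖)

/-- `v` is the value at `x` of the convolution `κ ∗ f`, for a kernel `κ` that may have a
non-integrable singularity at the origin. The integral `∫ κ(x-y) f(y) dy` is a Hadamard finite part:
the integral over `|x-y| > ε` equals a combination of negative powers of `ε` and of `log ε`, plus a
term that tends to `v` as `ε → 0+`. (If `y ↦ κ(x-y) f(y)` is integrable, `v` is its integral.) -/
def HasConvolution {n : ℕ} {F : Type*} [NormedAddCommGroup F] [NormedSpace ℝ F]
    (κ : Space n → ℝ) (f : Space n → F) (x : Space n) (v : F) : Prop :=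
  (∀ ε : ℝ, 0 < ε → IntegrableOn (fun y => κ (x - y) • f y) {y | ε < ‖x - y‖}) ∧
  ∃ (N : ℕ) (c : Fin N → F) (d : F),
    Tendsto (fun ε : ℝ => (∫ y in {y | ε < ‖x - y‖}, κ (x - y) • f y) -
        ((∑ i : Fin N, (1 / ε ^ ((i : ℕ) + 1)) • c i) + Real.log ε • d))
      (𝓝[>] 0) (𝓝 v)

/-- The partial derivative `∂f/∂x^j`. -/
def partialDeriv {n : ℕ} {F : Type*} [NormedAddCommGroup F] [NormedSpace ℝ F]
    (j : Fin n) (f : Space n → F) (x : Space n) : F :=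
  fderiv ℝ f x (EuclideanSpace.single j 1)

end ScalarFock

end

open ScalarFock

/-!
For `Ψ` in the domain, `p ↦ a(p) Ψ` is a continuous, rapidly decaying function with values in the
Fock space, and `x ↦ ã(x) Ψ` is its Fourier integral. By Plancherel's theorem for Hilbert space
valued functions, `∫ ã*(x) B(x) dx = ∫ σ(p) a*(p) a(p) dp` whenever `B(x) Ψ` is the Fourier integral
of `σ(p) a(p) Ψ`, and the right-hand side is the second quantization of multiplication by `σ`. It
remains to see that `i ∂_j` and the convolution with `ω̃` multiply the integrand by `p_j` and by
`ω_p`.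

The first is differentiation under the integral. For the second, subordination,
`2 √π ω_p = ∫ s^{-3/2} (1 - e^{-s ω_p²}) ds`, reduces `ω_p` to Gaussians. The function `e^{-s |p|²}`
is the cosine transform of the heat kernel, and the same integral over `s` of heat kernels is an
integral representation of the Bessel kernel `ω̃`. When `ω̃` is truncated to `|y| > ε`, the term `1`
contributes the integral of the massless kernel, which by homogeneity is a multiple of `1 / ε`: this
is the divergent part that the Hadamard finite part discards. The remainder tends to `ω_p`.

Uniqueness of `P_μ` holds because symmetrized Schwartz functions are dense in each `k`-particle
space.
-/

noncomputable section

namespace ScalarFock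

open scoped FourierTransform Real

/-! ### Fourier integrals of functions with values in a Hilbert space -/

section Plancherel

variable {E F H : Type*} [NormedAddCommGroup E] [InnerProductSpace ℝ E] [FiniteDimensional ℝ E]
  [MeasurableSpace E] [BorelSpace E] [NormedAddCommGroup F] [NormedSpace ℂ F]
  [NormedAddCommGroup H] [InnerProductSpace ℂ H] [CompleteSpace H]

theorem continuous_fourier_of_integrable {g : E → F} (hg : Integrable g) : Continuous (𝓕 g) :=
  VectorFourier.fourierIntegral_continuous Real.continuous_fourierChar continuous_inner hg

theorem integral_smul_fourier_eq [CompleteSpace F] {g : E → F} (φ : 𝓢(E, ℂ)) (hg : Integrable g) :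
    ∫ x, φ x • 𝓕 g x = ∫ x, 𝓕 φ x • g x := by
  have h := VectorFourier.integral_fourierIntegral_smul_eq_flip (L := innerₗ E)
    Real.continuous_fourierChar continuous_inner (φ.integrable (μ := volume)) hg
  rw [flip_innerₗ] at h
  rw [SchwartzMap.fourier_coe]
  exact h.symm

theorem fourier_ae_eq_fourier_toLp {g : E → H} (hg : Integrable g) (hg2 : MemLp g 2) :
    𝓕 g =ᵐ[volume] (𝓕 (hg2.toLp g) : Lp H 2 (volume : Measure E)) := by
  refine ae_eq_of_integral_contDiff_smul_eq (continuous_fourier_of_integrable hg).locallyIntegrable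
    ((Lp.memLp _).locallyIntegrable (by norm_num)) fun φ hφ hφc => ?_
  have hsupp : HasCompactSupport (fun x => (φ x : ℂ)) := hφc.comp_left (g := Complex.ofReal) rfl
  set ψ : 𝓢(E, ℂ) := hsupp.toSchwartzMap (Complex.ofRealCLM.contDiff.comp hφ)
  have h_distribution : ∫ x, 𝓕 ψ x • hg2.toLp g x = ∫ x, ψ x • 𝓕 (hg2.toLp g) x := by
    simpa only [TemperedDistribution.fourier_apply, Lp.toTemperedDistribution_apply] using
      DFunLike.congr_fun (Lp.fourier_toTemperedDistribution_eq (hg2.toLp g)) ψ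
  calc ∫ x, φ x • 𝓕 g x = ∫ x, 𝓕 ψ x • g x := integral_smul_fourier_eq ψ hg
    _ = ∫ x, 𝓕 ψ x • hg2.toLp g x := integral_congr_ae <| by
      filter_upwards [hg2.coeFn_toLp] with x hx
      rw [hx]
    _ = _ := h_distribution

theorem integrable_inner_fourier {f g : E → H} (hf : Integrable f) (hf2 : MemLp f 2)
    (hg : Integrable g) (hg2 : MemLp g 2) : Integrable (fun x => (inner ℂ (𝓕 f x) (𝓕 g x) : ℂ)) :=
  (L2.integrable_inner (𝕜 := ℂ) (𝓕 (hf2.toLp f)) (𝓕 (hg2.toLp g))).congr <|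
    ((fourier_ae_eq_fourier_toLp hf hf2).comp₂ (inner ℂ)
      (fourier_ae_eq_fourier_toLp hg hg2)).symm

theorem integral_inner_fourier {f g : E → H} (hf : Integrable f) (hf2 : MemLp f 2)
    (hg : Integrable g) (hg2 : MemLp g 2) :
    ∫ x, inner ℂ (𝓕 f x) (𝓕 g x) = ∫ x, inner ℂ (f x) (g x) := by
  calc ∫ x, inner ℂ (𝓕 f x) (𝓕 g x)
      = inner ℂ (𝓕 (hf2.toLp f) : Lp H 2 (volume : Measure E)) (𝓕 (hg2.toLp g)) :=
        integral_congr_ae <| (fourier_ae_eq_fourier_toLp hf hf2).comp₂ (inner ℂ)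
          (fourier_ae_eq_fourier_toLp hg hg2)
    _ = inner ℂ (hf2.toLp f) (hg2.toLp g) := Lp.inner_fourier_eq _ _
    _ = ∫ x, inner ℂ (f x) (g x) :=
        integral_congr_ae <| hf2.coeFn_toLp.comp₂ (inner ℂ) hg2.coeFn_toLp

end Plancherel

section WaveTransform

variable {E F H : Type*} [NormedAddCommGroup E] [InnerProductSpace ℝ E]
  [NormedAddCommGroup F] [NormedSpace ℂ F]

theorem I_smul_smulRight_inner_eq (g : E → F) :
    (fun p => Complex.I • (innerSL ℝ p).smulRight (g p)) =
      ((-(2 * π)⁻¹ : ℝ) : ℂ) • VectorFourier.fourierSMulRight (innerSL ℝ) g := by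
  funext p
  rw [Pi.smul_apply, VectorFourier.fourierSMulRight, smul_smul]
  congr 1
  have : (π : ℂ) ≠ 0 := by exact_mod_cast Real.pi_ne_zero
  push_cast
  field_simp

variable [FiniteDimensional ℝ E] [MeasurableSpace E] [BorelSpace E]
  [NormedAddCommGroup H] [InnerProductSpace ℂ H]

/-- The superposition `(2π)^{-n/2} ∫ e^{i⟪p, x⟫} g(p) dp` of plane waves with amplitude `g`, where
`n = dim E`: the inverse Fourier transform, in the unitary normalization with angular
frequencies. -/
def waveTransform (g : E → F) (x : E) : F :=
  (((2 * π) ^ (-(Module.finrank ℝ E : ℝ) / 2) : ℝ) : ℂ) •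
    ∫ p, Complex.exp (Complex.I * (inner ℝ p x : ℝ)) • g p

theorem integrable_planeWave_smul {g : E → F} (hg : Integrable g) (x : E) :
    Integrable (fun p => Complex.exp (Complex.I * (inner ℝ p x : ℝ)) • g p) :=
  hg.bdd_smul 1 (Continuous.aestronglyMeasurable (by fun_prop))
    (Eventually.of_forall fun p => (Complex.norm_exp_I_mul_ofReal _).le)

theorem waveTransform_sub {f g : E → F} (hf : Integrable f) (hg : Integrable g) (x : E) :
    waveTransform (fun p => f p - g p) x = waveTransform f x - waveTransform g x := by
  simp only [waveTransform, smul_sub]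
  rw [integral_sub (integrable_planeWave_smul hf x) (integrable_planeWave_smul hg x), smul_sub]

theorem waveTransform_const_smul (c : ℂ) (g : E → F) (x : E) :
    waveTransform (fun p => c • g p) x = c • waveTransform g x := by
  simp only [waveTransform, smul_comm _ c]
  rw [integral_smul, smul_comm]

theorem norm_waveTransform_le (g : E → F) (x : E) :
    ‖waveTransform g x‖ ≤ (2 * π) ^ (-(Module.finrank ℝ E : ℝ) / 2) * ∫ p, ‖g p‖ := by
  rw [waveTransform, norm_smul, Complex.norm_real, Real.norm_of_nonneg (by positivity)]
  gcongr
  refine (norm_integral_le_integral_norm _).trans_eq ?_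
  simp only [norm_smul, Complex.norm_exp_I_mul_ofReal, one_mul]

theorem waveTransform_eq_fourier (g : E → F) (x : E) :
    waveTransform g x = (((2 * π) ^ (-(Module.finrank ℝ E : ℝ) / 2) : ℝ) : ℂ) •
      𝓕 g ((-(2 * π)⁻¹ : ℝ) • x) := by
  rw [waveTransform, Real.fourier_eq]
  congr 1
  refine integral_congr_ae (Eventually.of_forall fun p => ?_)
  simp only [Circle.smul_def, Real.fourierChar_apply, inner_smul_right]
  congr 2
  push_cast
  have : (π : ℂ) ≠ 0 := by exact_mod_cast Real.pi_ne_zero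
  field_simp

theorem continuous_waveTransform {g : E → F} (hg : Integrable g) :
    Continuous (waveTransform g) := by
  simp_rw [funext (waveTransform_eq_fourier g)]
  exact ((continuous_fourier_of_integrable hg).comp (continuous_const_smul _)).const_smul _

theorem inner_waveTransform_eq_inner_fourier (f g : E → H) (x : E) :
    (inner ℂ (waveTransform f x) (waveTransform g x) : ℂ) =
      (((2 * π) ^ (-(Module.finrank ℝ E : ℝ)) : ℝ) : ℂ) *
        inner ℂ (𝓕 f ((-(2 * π)⁻¹ : ℝ) • x)) (𝓕 g ((-(2 * π)⁻¹ : ℝ) • x)) := by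
  rw [waveTransform_eq_fourier, waveTransform_eq_fourier, inner_smul_left, inner_smul_right,
    Complex.conj_ofReal, ← mul_assoc, ← Complex.ofReal_mul, ← Real.rpow_add Real.two_pi_pos,
    add_halves]

theorem integrable_inner_waveTransform [CompleteSpace H] {f g : E → H}
    (hf : Integrable f) (hf2 : MemLp f 2) (hg : Integrable g) (hg2 : MemLp g 2) :
    Integrable (fun x => (inner ℂ (waveTransform f x) (waveTransform g x) : ℂ)) := by
  simp only [inner_waveTransform_eq_inner_fourier]
  exact ((integrable_inner_fourier hf hf2 hg hg2).comp_smul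
    (neg_ne_zero.2 (inv_ne_zero Real.two_pi_pos.ne'))).const_mul _

theorem integral_inner_waveTransform [CompleteSpace H] {f g : E → H}
    (hf : Integrable f) (hf2 : MemLp f 2) (hg : Integrable g) (hg2 : MemLp g 2) :
    ∫ x, inner ℂ (waveTransform f x) (waveTransform g x) = ∫ x, inner ℂ (f x) (g x) := by
  have h_jacobian : (2 * π) ^ (-(Module.finrank ℝ E : ℝ)) *
      |((-(2 * π)⁻¹ : ℝ) ^ Module.finrank ℝ E)⁻¹| = 1 := by
    rw [abs_inv, abs_pow, abs_neg, abs_of_pos (by positivity), inv_pow, inv_inv,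
      Real.rpow_neg (by positivity), Real.rpow_natCast, inv_mul_cancel₀ (by positivity)]
  simp only [inner_waveTransform_eq_inner_fourier]
  rw [integral_const_mul, Measure.integral_comp_smul volume (fun y => inner ℂ (𝓕 f y) (𝓕 g y)),
    integral_inner_fourier hf hf2 hg hg2, Complex.real_smul, ← mul_assoc, ← Complex.ofReal_mul,
    h_jacobian, Complex.ofReal_one, one_mul]

theorem hasFDerivAt_waveTransform {g : E → F} (hg : Integrable g)
    (hg1 : Integrable (fun p => ‖p‖ * ‖g p‖)) (x : E) :
    HasFDerivAt (waveTransform g)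
      (waveTransform (fun p => Complex.I • (innerSL ℝ p).smulRight (g p)) x) x := by
  have h_scale := (hasFDerivAt_id (𝕜 := ℝ) x).const_smul (-(2 * π)⁻¹ : ℝ)
  have h := ((Real.hasFDerivAt_fourier hg hg1 ((-(2 * π)⁻¹ : ℝ) • x)).comp x h_scale).const_smul
    (((2 * π) ^ (-(Module.finrank ℝ E : ℝ) / 2) : ℝ) : ℂ)
  refine (h.congr_of_eventuallyEq (.of_forall (waveTransform_eq_fourier g))).congr_fderiv ?_
  rw [I_smul_smulRight_inner_eq, waveTransform_eq_fourier, Real.fourier_eq, Real.fourier_eq]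
  simp only [Pi.smul_apply, smul_comm _ ((-(2 * π)⁻¹ : ℝ) : ℂ)]
  rw [integral_smul]
  simp only [Complex.coe_smul]
  ext v
  simp

theorem fderiv_waveTransform_apply [CompleteSpace F] {g : E → F} (hg : Integrable g)
    (hg1 : Integrable (fun p => ‖p‖ * ‖g p‖)) (x v : E) :
    fderiv ℝ (waveTransform g) x v =
      waveTransform (fun p => (Complex.I * (inner ℝ p v : ℝ)) • g p) x := by
  have h_integrable : Integrable (fun p => Complex.I • (innerSL ℝ p).smulRight (g p)) := by
    refine hg1.mono' ?_ (Eventually.of_forall fun p => ?_)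
    · rw [I_smul_smulRight_inner_eq]
      exact hg.1.fourierSMulRight.const_smul _
    · simp [norm_smul]
  rw [(hasFDerivAt_waveTransform hg hg1 x).fderiv, waveTransform, waveTransform,
    smul_apply, ContinuousLinearMap.integral_apply (integrable_planeWave_smul h_integrable x)]
  simp [mul_smul]

end WaveTransform

/-! ### Subordination of powers to exponentials -/

section Subordination

variable {α A s : ℝ}

theorem one_sub_exp_neg_nonneg (hA : 0 ≤ A) (hs : 0 ≤ s) : 0 ≤ 1 - Real.exp (-(A * s)) :=
  sub_nonneg.2 (Real.exp_le_one_iff.2 (neg_nonpos.2 (by positivity)))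

theorem rpow_mul_one_sub_exp_neg_le (α : ℝ) (A : ℝ) (hs : 0 < s) :
    s ^ α * (1 - Real.exp (-(A * s))) ≤ A * s ^ (α + 1) := by
  have h := Real.one_sub_le_exp_neg (A * s)
  calc s ^ α * (1 - Real.exp (-(A * s))) ≤ s ^ α * (A * s) := by gcongr; linarith
    _ = A * s ^ (α + 1) := by rw [Real.rpow_add_one hs.ne']; ring

theorem rpow_mul_one_sub_exp_neg_le_rpow (α A : ℝ) (hs : 0 ≤ s) :
    s ^ α * (1 - Real.exp (-(A * s))) ≤ s ^ α :=
  mul_le_of_le_one_right (by positivity) (sub_le_self _ (Real.exp_nonneg _))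

theorem integrableOn_rpow_mul_one_sub_exp_neg (hα0 : 0 < α) (hα1 : α < 1) (hA : 0 ≤ A) :
    IntegrableOn (fun s : ℝ => s ^ (-α - 1) * (1 - Real.exp (-(A * s)))) (Set.Ioi 0) := by
  have h_meas : Measurable (fun s : ℝ => s ^ (-α - 1) * (1 - Real.exp (-(A * s)))) := by fun_prop
  have h_norm : ∀ s : ℝ, 0 < s → ‖s ^ (-α - 1) * (1 - Real.exp (-(A * s)))‖ =
      s ^ (-α - 1) * (1 - Real.exp (-(A * s))) := fun s hs =>
    Real.norm_of_nonneg (mul_nonneg (by positivity) (one_sub_exp_neg_nonneg hA hs.le))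
  rw [← Set.Ioc_union_Ioi_eq_Ioi zero_le_one]
  refine IntegrableOn.union ?_ ?_
  · have h : IntegrableOn (fun s : ℝ => s ^ (-α)) (Set.Ioc 0 1) :=
      (intervalIntegrable_iff_integrableOn_Ioc_of_le zero_le_one).1
        (intervalIntegral.intervalIntegrable_rpow' (by linarith))
    refine (h.const_mul A).mono' h_meas.aestronglyMeasurable ?_
    filter_upwards [ae_restrict_mem measurableSet_Ioc] with s hs
    rw [h_norm s hs.1]
    simpa using rpow_mul_one_sub_exp_neg_le (-α - 1) A hs.1
  · have h : IntegrableOn (fun s : ℝ => s ^ (-α - 1)) (Set.Ioi 1) :=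
      integrableOn_Ioi_rpow_of_lt (by linarith) zero_lt_one
    refine h.mono' h_meas.aestronglyMeasurable ?_
    filter_upwards [ae_restrict_mem measurableSet_Ioi] with s hs
    have hs0 : 0 < s := zero_lt_one.trans hs
    rw [h_norm s hs0]
    exact rpow_mul_one_sub_exp_neg_le_rpow _ A hs0.le

theorem integrableOn_rpow_neg_mul_exp_neg (hα1 : α < 1) (hA : 0 < A) :
    IntegrableOn (fun s : ℝ => s ^ (-α) * Real.exp (-(A * s))) (Set.Ioi 0) := by
  simpa [Real.rpow_one] using integrableOn_rpow_mul_exp_neg_mul_rpow (p := 1) (s := -α) (b := A)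
    (by linarith) one_pos hA

theorem tendsto_rpow_mul_one_sub_exp_neg_zero (hα1 : α < 1) (hA : 0 ≤ A) :
    Tendsto (fun s : ℝ => s ^ (-α) * (1 - Real.exp (-(A * s)))) (𝓝[>] 0) (𝓝 0) := by
  have h_bound : Tendsto (fun s : ℝ => A * s ^ (-α + 1)) (𝓝[>] 0) (𝓝 0) := by
    have h := ((Real.continuousAt_rpow_const 0 (-α + 1) (Or.inr (by linarith))).tendsto.const_mul
      A).mono_left (nhdsWithin_le_nhds (s := Set.Ioi (0 : ℝ)))
    rwa [Real.zero_rpow (by linarith), mul_zero] at h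
  refine squeeze_zero' ?_ ?_ h_bound
  all_goals filter_upwards [self_mem_nhdsWithin] with s (hs : 0 < s)
  · exact mul_nonneg (by positivity) (one_sub_exp_neg_nonneg hA hs.le)
  · exact rpow_mul_one_sub_exp_neg_le (-α) A hs

theorem tendsto_rpow_mul_one_sub_exp_neg_atTop (hα0 : 0 < α) (hA : 0 ≤ A) :
    Tendsto (fun s : ℝ => s ^ (-α) * (1 - Real.exp (-(A * s)))) atTop (𝓝 0) := by
  refine squeeze_zero' ?_ ?_ (tendsto_rpow_neg_atTop hα0)
  all_goals filter_upwards [eventually_ge_atTop 0] with s hs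
  · exact mul_nonneg (by positivity) (one_sub_exp_neg_nonneg hA hs)
  · exact rpow_mul_one_sub_exp_neg_le_rpow (-α) A hs

theorem hasDerivAt_one_sub_exp_neg_mul (A s : ℝ) :
    HasDerivAt (fun s => 1 - Real.exp (-(A * s))) (A * Real.exp (-(A * s))) s := by
  refine ((((hasDerivAt_id s).const_mul A).neg.exp).const_sub 1).congr_deriv ?_
  rw [Pi.neg_apply, id_eq, mul_one, mul_neg, neg_neg, mul_comm]

theorem hasDerivAt_neg_inv_mul_rpow_neg (hα : α ≠ 0) (hs : 0 < s) :
    HasDerivAt (fun s : ℝ => -α⁻¹ * s ^ (-α)) (s ^ (-α - 1)) s := by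
  refine ((Real.hasDerivAt_rpow_const (p := -α) (Or.inl hs.ne')).const_mul (-α⁻¹)).congr_deriv ?_
  field_simp

theorem integral_rpow_mul_one_sub_exp_neg_eq_integral_mul_exp (hα0 : 0 < α) (hα1 : α < 1)
    (hA : 0 < A) :
    ∫ s in Set.Ioi (0 : ℝ), s ^ (-α - 1) * (1 - Real.exp (-(A * s))) =
      A / α * ∫ s in Set.Ioi (0 : ℝ), s ^ (-α) * Real.exp (-(A * s)) := by
  have h_boundary {l : Filter ℝ}
      (h : Tendsto (fun s : ℝ => s ^ (-α) * (1 - Real.exp (-(A * s)))) l (𝓝 0)) :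
      Tendsto ((fun s => 1 - Real.exp (-(A * s))) * fun s : ℝ => -α⁻¹ * s ^ (-α)) l (𝓝 0) := by
    refine (mul_zero (-α⁻¹) ▸ h.const_mul (-α⁻¹)).congr fun s => ?_
    simp only [Pi.mul_apply]; ring
  have h_int := integrableOn_rpow_mul_one_sub_exp_neg hα0 hα1 hA.le
  have h_int' := integrableOn_rpow_neg_mul_exp_neg hα1 hA
  have h_parts := integral_Ioi_mul_deriv_eq_deriv_mul
    (fun s _ => hasDerivAt_one_sub_exp_neg_mul A s)
    (fun s hs => hasDerivAt_neg_inv_mul_rpow_neg hα0.ne' hs)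
    (h_int.congr_fun (fun s _ => mul_comm _ _) measurableSet_Ioi)
    (IntegrableOn.congr_fun (h_int'.const_mul (-(A / α)))
      (fun s _ => by simp only [Pi.mul_apply]; ring) measurableSet_Ioi)
    (h_boundary (tendsto_rpow_mul_one_sub_exp_neg_zero hα1 hA.le))
    (h_boundary (tendsto_rpow_mul_one_sub_exp_neg_atTop hα0 hA.le))
  simp only [mul_comm (_ ^ (-α - 1))]
  rw [h_parts, sub_zero, zero_sub, ← integral_neg, ← integral_const_mul]
  congr 1 with s
  ring

theorem integral_rpow_mul_one_sub_exp_neg (hα0 : 0 < α) (hα1 : α < 1) (hA : 0 < A) :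
    ∫ s in Set.Ioi (0 : ℝ), s ^ (-α - 1) * (1 - Real.exp (-(A * s))) =
      Real.Gamma (1 - α) / α * A ^ α := by
  have h_gamma : ∫ s in Set.Ioi (0 : ℝ), s ^ (-α) * Real.exp (-(A * s)) =
      (1 / A) ^ (1 - α) * Real.Gamma (1 - α) := by
    simpa only [sub_sub_cancel_left] using
      Real.integral_rpow_mul_exp_neg_mul_Ioi (sub_pos.2 hα1) hA
  rw [integral_rpow_mul_one_sub_exp_neg_eq_integral_mul_exp hα0 hα1 hA, h_gamma, one_div,
    Real.inv_rpow hA.le, Real.rpow_sub hA, Real.rpow_one]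
  field_simp

end Subordination

/-! ### The heat kernel -/

section HeatKernel

variable {E : Type*} [NormedAddCommGroup E] [InnerProductSpace ℝ E] {s : ℝ}

/-- The heat kernel `(4πs)^{-n/2} e^{-|y|²/(4s)}` at time `s`, where `n = dim E`. -/
def heatKernel (s : ℝ) (y : E) : ℝ :=
  (4 * π * s) ^ (-(Module.finrank ℝ E : ℝ) / 2) * Real.exp (-(4 * s)⁻¹ * ‖y‖ ^ 2)

theorem heatKernel_nonneg (hs : 0 ≤ s) (y : E) : 0 ≤ heatKernel s y := by
  unfold heatKernel; positivity

theorem heatKernel_mul_planeWave (s : ℝ) (p y : E) :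
    (heatKernel s y : ℂ) * Complex.exp (Complex.I * (inner ℝ p y : ℝ)) =
      (((4 * π * s) ^ (-(Module.finrank ℝ E : ℝ) / 2) : ℝ) : ℂ) *
        Complex.exp (-(((4 * s)⁻¹ : ℝ) : ℂ) * ‖y‖ ^ 2 + Complex.I * (inner ℝ p y : ℝ)) := by
  rw [heatKernel, Complex.exp_add]
  push_cast
  ring

variable [MeasurableSpace E] [BorelSpace E]

theorem measurable_heatKernel : Measurable (fun z : ℝ × E => heatKernel z.1 z.2) := by
  unfold heatKernel; fun_prop

variable [FiniteDimensional ℝ E]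

theorem integrable_heatKernel_mul_planeWave (hs : 0 < s) (p : E) :
    Integrable (fun y => (heatKernel s y : ℂ) * Complex.exp (Complex.I * (inner ℝ p y : ℝ))) := by
  simp only [heatKernel_mul_planeWave]
  exact (GaussianFourier.integrable_cexp_neg_mul_sq_norm_add
    (by rw [Complex.ofReal_re]; positivity) Complex.I p).const_mul _

theorem integral_heatKernel_mul_planeWave (hs : 0 < s) (p : E) :
    ∫ y, (heatKernel s y : ℂ) * Complex.exp (Complex.I * (inner ℝ p y : ℝ)) =
      (Real.exp (-(‖p‖ ^ 2 * s)) : ℝ) := by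
  have h_mass : ((π : ℂ) / (((4 * s)⁻¹ : ℝ) : ℂ)) ^ ((Module.finrank ℝ E : ℂ) / 2) =
      (((4 * π * s) ^ ((Module.finrank ℝ E : ℝ) / 2) : ℝ) : ℂ) := by
    rw [Complex.ofReal_cpow (by positivity)]
    push_cast
    congr 1
    field_simp
  have h_decay : Complex.exp (Complex.I ^ 2 * ‖p‖ ^ 2 / (4 * (((4 * s)⁻¹ : ℝ) : ℂ))) =
      (Real.exp (-(‖p‖ ^ 2 * s)) : ℝ) := by
    push_cast
    rw [Complex.I_sq]
    congr 1
    field_simp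
  simp only [heatKernel_mul_planeWave]
  rw [integral_const_mul, GaussianFourier.integral_cexp_neg_mul_sq_norm_add
    (by rw [Complex.ofReal_re]; positivity) Complex.I p, h_mass, h_decay, ← mul_assoc,
    ← Complex.ofReal_mul, ← Real.rpow_add (by positivity), neg_div, neg_add_cancel,
    Real.rpow_zero, Complex.ofReal_one, one_mul]

theorem integrable_heatKernel (hs : 0 < s) : Integrable (heatKernel s : E → ℝ) := by
  simpa using (integrable_heatKernel_mul_planeWave hs (0 : E)).re

theorem integrable_heatKernel_mul_cos (hs : 0 < s) (p : E) :
    Integrable (fun y => heatKernel s y * Real.cos (inner ℝ p y)) :=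
  (integrable_heatKernel hs).mul_bdd (c := 1) (by fun_prop)
    (Eventually.of_forall fun _ => Real.abs_cos_le_one _)

theorem integral_heatKernel_mul_cos (hs : 0 < s) (p : E) :
    ∫ y, heatKernel s y * Real.cos (inner ℝ p y) = Real.exp (-(‖p‖ ^ 2 * s)) := by
  have h := congrArg Complex.re (integral_heatKernel_mul_planeWave hs p)
  rw [← RCLike.re_eq_complex_re, ← integral_re (integrable_heatKernel_mul_planeWave hs p)] at h
  simpa only [RCLike.re_eq_complex_re, Complex.ofReal_re, Complex.re_ofReal_mul,
    mul_comm Complex.I, Complex.exp_ofReal_mul_I_re] using h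

theorem integral_heatKernel (hs : 0 < s) : ∫ y : E, heatKernel s y = 1 := by
  simpa using integral_heatKernel_mul_cos hs (0 : E)

end HeatKernel

/-! ### Gamma and Macdonald integrals -/

section Macdonald

variable {a b ν : ℝ}

theorem integrableOn_rpow_mul_exp_neg_div (hν : 0 < ν) (hb : 0 < b) :
    IntegrableOn (fun s : ℝ => s ^ (-ν - 1) * Real.exp (-(b / s))) (Set.Ioi 0) := by
  have h : IntegrableOn (fun t : ℝ => t ^ (ν - 1) * Real.exp (-(b * t))) (Set.Ioi 0) := by
    simpa using integrableOn_rpow_mul_exp_neg_mul_rpow (p := 1) (s := ν - 1) (b := b)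
      (by linarith) one_pos hb
  refine ((integrableOn_Ioi_comp_rpow_iff' _ (neg_ne_zero.2 one_ne_zero)).2 h).congr_fun
    (fun s (hs : 0 < s) => ?_) measurableSet_Ioi
  simp only [smul_eq_mul]
  rw [← mul_assoc, ← Real.rpow_mul hs.le, ← Real.rpow_add hs, Real.rpow_neg_one, ← div_eq_mul_inv]
  ring_nf

theorem integral_rpow_mul_exp_neg_div (hν : 0 < ν) (hb : 0 < b) :
    ∫ s in Set.Ioi (0 : ℝ), s ^ (-ν - 1) * Real.exp (-(b / s)) = (1 / b) ^ ν * Real.Gamma ν := by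
  rw [← Real.integral_rpow_mul_exp_neg_mul_Ioi hν hb,
    ← integral_comp_rpow_Ioi _ (neg_ne_zero.2 one_ne_zero)]
  refine setIntegral_congr_fun measurableSet_Ioi fun s (hs : 0 < s) => ?_
  simp only [smul_eq_mul]
  rw [← mul_assoc, abs_neg, abs_one, one_mul, ← Real.rpow_mul hs.le, ← Real.rpow_add hs,
    Real.rpow_neg_one, div_inv_eq_mul]
  ring_nf

theorem integrableOn_rpow_mul_exp_neg_mul_sub_div (hν : 0 < ν) (ha : 0 ≤ a) (hb : 0 < b) :
    IntegrableOn (fun s : ℝ => s ^ (-ν - 1) * Real.exp (-(a * s) - b / s)) (Set.Ioi 0) := by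
  refine (integrableOn_rpow_mul_exp_neg_div hν hb).mono'
    (Measurable.aestronglyMeasurable (by fun_prop)) ?_
  filter_upwards [ae_restrict_mem measurableSet_Ioi] with s (hs : 0 < s)
  rw [Real.norm_of_nonneg (by positivity)]
  gcongr
  linarith [mul_nonneg ha hs.le]

theorem range_mul_exp {c : ℝ} (hc : 0 < c) : Set.range (fun t => c * Real.exp t) = Set.Ioi 0 := by
  ext s
  refine ⟨fun ⟨t, ht⟩ => ht ▸ mul_pos hc (Real.exp_pos t), fun (hs : 0 < s) => ?_⟩
  exact ⟨Real.log (s / c), by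
    simp only [Real.exp_log (div_pos hs hc), mul_div_cancel₀ s hc.ne']⟩

theorem injective_mul_exp {c : ℝ} (hc : 0 < c) : Function.Injective fun t => c * Real.exp t :=
  fun _ _ h => Real.exp_injective (mul_left_cancel₀ hc.ne' h)

theorem integrable_comp_mul_exp_iff {g : ℝ → ℝ} {c : ℝ} (hc : 0 < c) :
    Integrable (fun t => c * Real.exp t * g (c * Real.exp t)) ↔ IntegrableOn g (Set.Ioi 0) := by
  rw [← range_mul_exp hc, ← Set.image_univ,
    integrableOn_image_iff_integrableOn_abs_deriv_smul MeasurableSet.univ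
      (fun t _ => ((Real.hasDerivAt_exp t).const_mul c).hasDerivWithinAt)
      (injective_mul_exp hc).injOn, integrableOn_univ]
  simp only [abs_of_pos (mul_pos hc (Real.exp_pos _)), smul_eq_mul]

theorem integral_comp_mul_exp (g : ℝ → ℝ) {c : ℝ} (hc : 0 < c) :
    ∫ t, c * Real.exp t * g (c * Real.exp t) = ∫ s in Set.Ioi 0, g s := by
  rw [← range_mul_exp hc, ← Set.image_univ,
    integral_image_eq_integral_abs_deriv_smul MeasurableSet.univ
      (fun t _ => ((Real.hasDerivAt_exp t).const_mul c).hasDerivWithinAt)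
      (injective_mul_exp hc).injOn, setIntegral_univ]
  simp only [abs_of_pos (mul_pos hc (Real.exp_pos _)), smul_eq_mul]

theorem mul_exp_mul_rpow_mul_exp_eq (ha : 0 < a) (hb : 0 < b) (ν t : ℝ) :
    b / a * Real.exp t * ((b / a * Real.exp t) ^ (-ν - 1) *
        Real.exp (-(a ^ 2 * (b / a * Real.exp t)) - b ^ 2 / (b / a * Real.exp t))) =
      (a / b) ^ ν * (Real.exp (-(2 * a * b) * Real.cosh t) * Real.exp (-ν * t)) := by
  have h_pos : 0 < b / a * Real.exp t := by positivity
  have h_power : b / a * Real.exp t * (b / a * Real.exp t) ^ (-ν - 1) =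
      (a / b) ^ ν * Real.exp (-ν * t) := by
    rw [mul_comm, ← Real.rpow_add_one h_pos.ne', sub_add_cancel,
      Real.mul_rpow (by positivity) (by positivity), ← Real.exp_mul, mul_comm t,
      Real.rpow_neg (by positivity), ← Real.inv_rpow (by positivity), inv_div]
  have h_exponent : -(a ^ 2 * (b / a * Real.exp t)) - b ^ 2 / (b / a * Real.exp t) =
      -(2 * a * b) * Real.cosh t := by
    rw [Real.cosh_eq, Real.exp_neg]
    field_simp
    ring
  rw [← mul_assoc, h_power, h_exponent]
  ring

theorem integrable_exp_neg_mul_cosh_mul_exp {z : ℝ} (hν : 0 < ν) (hz : 0 < z) :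
    Integrable (fun t => Real.exp (-z * Real.cosh t) * Real.exp (-ν * t)) := by
  have h := (integrable_comp_mul_exp_iff (div_pos (half_pos hz) one_pos)).2
    (integrableOn_rpow_mul_exp_neg_mul_sub_div hν (a := 1 ^ 2) (by positivity)
      (pow_pos (half_pos hz) 2))
  simp only [mul_exp_mul_rpow_mul_exp_eq one_pos (half_pos hz)] at h
  rw [integrable_const_mul_iff (by positivity : (1 / (z / 2)) ^ ν ≠ 0).isUnit] at h
  simpa only [mul_one, mul_div_cancel₀ z two_ne_zero] using h

theorem integral_exp_neg_mul_cosh_mul_exp {z : ℝ} (hν : 0 < ν) (hz : 0 < z) :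
    ∫ t, Real.exp (-z * Real.cosh t) * Real.exp (-ν * t) = 2 * besselK ν z := by
  have h := integrable_exp_neg_mul_cosh_mul_exp hν hz
  have h_sum : ∀ t, Real.exp (-z * Real.cosh t) * Real.exp (-ν * t) +
      Real.exp (-z * Real.cosh (-t)) * Real.exp (-ν * -t) =
        2 * (Real.exp (-z * Real.cosh |t|) * Real.cosh (ν * |t|)) := by
    intro t
    have h_even : Real.cosh (ν * |t|) = Real.cosh (ν * t) := by
      rw [← abs_of_pos hν, ← abs_mul, Real.cosh_abs, abs_of_pos hν]
    rw [h_even, Real.cosh_abs, Real.cosh_neg, Real.cosh_eq (ν * t)]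
    ring_nf
  have h_add := integral_add h h.comp_neg
  simp only [h_sum] at h_add
  rw [integral_const_mul, integral_neg_eq_self (fun t => Real.exp (-z * Real.cosh t) *
    Real.exp (-ν * t)), integral_comp_abs (f := fun t => Real.exp (-z * Real.cosh t) *
    Real.cosh (ν * t)), ← besselK] at h_add
  linarith

theorem integral_rpow_mul_exp_neg_sq_sub_sq_div (ha : 0 < a) (hb : 0 < b) (hν : 0 < ν) :
    ∫ s in Set.Ioi (0 : ℝ), s ^ (-ν - 1) * Real.exp (-(a ^ 2 * s) - b ^ 2 / s) =
      2 * (a / b) ^ ν * besselK ν (2 * a * b) := by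
  rw [← integral_comp_mul_exp _ (div_pos hb ha)]
  simp only [mul_exp_mul_rpow_mul_exp_eq ha hb]
  rw [integral_const_mul, integral_exp_neg_mul_cosh_mul_exp hν (by positivity)]
  ring

end Macdonald

/-! ### Subordinated heat kernels -/

theorem ne_zero_of_mem_compl_closedBall {E : Type*} [SeminormedAddCommGroup E] {ε : ℝ} {y : E}
    (hε : 0 ≤ ε) (hy : y ∈ (Metric.closedBall (0 : E) ε)ᶜ) : y ≠ 0 := by
  rintro rfl
  exact hy (Metric.mem_closedBall_self hε)

section ExteriorIntegrals

open scoped Pointwise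

variable {E : Type*} [NormedAddCommGroup E] [NormedSpace ℝ E] [MeasurableSpace E] [BorelSpace E]
  [FiniteDimensional ℝ E] {μ : Measure E} [μ.IsAddHaarMeasure] {ε r : ℝ}

theorem integrableOn_norm_rpow_compl_closedBall (hr : (Module.finrank ℝ E : ℝ) < r) (hε : 0 < ε) :
    IntegrableOn (fun y : E => ‖y‖ ^ (-r)) (Metric.closedBall 0 ε)ᶜ μ := by
  have hr0 : 0 ≤ r := (Nat.cast_nonneg _).trans hr.le
  refine ((integrable_one_add_norm hr).const_mul ((1 / ε + 1) ^ r)).integrableOn.mono'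
    (Measurable.aestronglyMeasurable (by fun_prop)) ?_
  filter_upwards [ae_restrict_mem measurableSet_closedBall.compl] with y hy
  have hy : ε < ‖y‖ := by simpa using hy
  have hy0 : 0 < ‖y‖ := hε.trans hy
  have h_le : 1 + ‖y‖ ≤ (1 / ε + 1) * ‖y‖ := by
    have : 1 ≤ 1 / ε * ‖y‖ := by rw [one_div_mul_eq_div, one_le_div hε]; exact hy.le
    linarith
  rw [Real.norm_of_nonneg (by positivity), Real.rpow_neg hy0.le, Real.rpow_neg (by positivity),
    ← div_eq_mul_inv, inv_le_comm₀ (by positivity) (by positivity), inv_div,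
    div_le_iff₀ (by positivity), ← Real.mul_rpow (by positivity) (by positivity), mul_comm ‖y‖]
  gcongr

theorem setIntegral_norm_rpow_compl_closedBall (hε : 0 < ε) (r : ℝ) :
    ∫ y in (Metric.closedBall (0 : E) ε)ᶜ, ‖y‖ ^ (-r) ∂μ =
      ε ^ (Module.finrank ℝ E - r) * ∫ y in (Metric.closedBall (0 : E) 1)ᶜ, ‖y‖ ^ (-r) ∂μ := by
  have h_smul : ε • (Metric.closedBall (0 : E) 1)ᶜ = (Metric.closedBall (0 : E) ε)ᶜ := by
    ext y
    rw [Set.mem_smul_set_iff_inv_smul_mem₀ hε.ne', Set.mem_compl_iff, Set.mem_compl_iff,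
      ← Set.mem_smul_set_iff_inv_smul_mem₀ hε.ne', _root_.smul_closedBall _ _ zero_le_one,
      smul_zero, mul_one, Real.norm_of_nonneg hε.le]
  have h := Measure.setIntegral_comp_smul_of_pos μ (fun y : E => ‖y‖ ^ (-r))
    (Metric.closedBall (0 : E) 1)ᶜ hε
  simp only [norm_smul, Real.norm_of_nonneg hε.le, Real.mul_rpow hε.le (norm_nonneg _)] at h
  rw [h_smul, integral_const_mul, smul_eq_mul, eq_inv_mul_iff_mul_eq₀ (by positivity)] at h
  rw [← h, ← mul_assoc, sub_eq_add_neg, Real.rpow_add hε, Real.rpow_natCast]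

end ExteriorIntegrals

section SubordinationKernel

variable {E : Type*} [NormedAddCommGroup E] [InnerProductSpace ℝ E] {α A s ε : ℝ} {y : E}

/-- The function `∫₀^∞ s^{-α-1} e^{-As} hₛ(y) ds`, where `hₛ` is the heat kernel. Off the diagonal,
`-α / Γ(1-α)` times it is the convolution kernel of `(A - Δ)^α`, for `0 < α < 1`. -/
def subordinationKernel (α A : ℝ) (y : E) : ℝ :=
  ∫ s in Set.Ioi (0 : ℝ), s ^ (-α - 1) * (Real.exp (-(A * s)) * heatKernel s y)

theorem rpow_mul_exp_neg_mul_heatKernel (hs : 0 < s) (α A : ℝ) (y : E) :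
    s ^ (-α - 1) * (Real.exp (-(A * s)) * heatKernel s y) =
      (4 * π) ^ (-(Module.finrank ℝ E : ℝ) / 2) *
        (s ^ (-(α + (Module.finrank ℝ E : ℝ) / 2) - 1) *
          Real.exp (-(A * s) - (‖y‖ / 2) ^ 2 / s)) := by
  have h_power : s ^ (-(α + (Module.finrank ℝ E : ℝ) / 2) - 1) =
      s ^ (-α - 1) * s ^ (-(Module.finrank ℝ E : ℝ) / 2) := by
    rw [← Real.rpow_add hs]
    ring_nf
  have h_exp : Real.exp (-(A * s) - (‖y‖ / 2) ^ 2 / s) =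
      Real.exp (-(A * s)) * Real.exp (-(4 * s)⁻¹ * ‖y‖ ^ 2) := by
    rw [← Real.exp_add]
    congr 1
    field_simp
    ring
  rw [heatKernel, Real.mul_rpow (by positivity) hs.le, h_power, h_exp]
  ring

theorem integrableOn_rpow_mul_exp_neg_mul_heatKernel (hα : 0 < α) (hA : 0 ≤ A) (hy : y ≠ 0) :
    IntegrableOn (fun s : ℝ => s ^ (-α - 1) * (Real.exp (-(A * s)) * heatKernel s y))
      (Set.Ioi 0) := by
  have h_pos : 0 < (‖y‖ / 2) ^ 2 := pow_pos (half_pos (norm_pos_iff.2 hy)) 2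
  exact IntegrableOn.congr_fun
    ((integrableOn_rpow_mul_exp_neg_mul_sub_div (by positivity) hA h_pos).const_mul _)
    (fun s hs => (rpow_mul_exp_neg_mul_heatKernel hs α A y).symm) measurableSet_Ioi

theorem subordinationKernel_nonneg (α A : ℝ) (y : E) : 0 ≤ subordinationKernel α A y :=
  setIntegral_nonneg measurableSet_Ioi fun s (hs : 0 < s) =>
    mul_nonneg (by positivity) (mul_nonneg (Real.exp_nonneg _) (heatKernel_nonneg hs.le y))

theorem subordinationKernel_le_zero (hα : 0 < α) (hA : 0 ≤ A) (hy : y ≠ 0) :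
    subordinationKernel α A y ≤ subordinationKernel α 0 y := by
  refine setIntegral_mono_on (integrableOn_rpow_mul_exp_neg_mul_heatKernel hα hA hy)
    (integrableOn_rpow_mul_exp_neg_mul_heatKernel hα le_rfl hy) measurableSet_Ioi
    fun s (hs : 0 < s) => ?_
  have := heatKernel_nonneg hs.le y
  gcongr

theorem subordinationKernel_zero (hα : 0 < α) (hy : y ≠ 0) :
    subordinationKernel α 0 y = (4 * π) ^ (-(Module.finrank ℝ E : ℝ) / 2) *
      (4 ^ (α + (Module.finrank ℝ E : ℝ) / 2) * Real.Gamma (α + (Module.finrank ℝ E : ℝ) / 2)) *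
        ‖y‖ ^ (-(Module.finrank ℝ E + 2 * α)) := by
  have h_norm : 0 < ‖y‖ := norm_pos_iff.2 hy
  have h_pos : 0 < (‖y‖ / 2) ^ 2 := by positivity
  rw [subordinationKernel, setIntegral_congr_fun measurableSet_Ioi fun s hs =>
    rpow_mul_exp_neg_mul_heatKernel hs α 0 y, integral_const_mul]
  simp only [zero_mul, neg_zero, zero_sub]
  rw [integral_rpow_mul_exp_neg_div (by positivity) h_pos]
  have : (1 / (‖y‖ / 2) ^ 2) ^ (α + (Module.finrank ℝ E : ℝ) / 2) =
      4 ^ (α + (Module.finrank ℝ E : ℝ) / 2) * ‖y‖ ^ (-(Module.finrank ℝ E + 2 * α)) := by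
    have h : 1 / (‖y‖ / 2) ^ 2 = 4 * ‖y‖ ^ (-2 : ℝ) := by
      rw [Real.rpow_neg h_norm.le, Real.rpow_ofNat]
      field_simp
      norm_num
    rw [h, Real.mul_rpow (by norm_num) (by positivity), ← Real.rpow_mul h_norm.le]
    ring_nf
  rw [this]
  ring

theorem integral_compensated_heatKernel (hα : 0 < α) (hA : 0 ≤ A) (p : E) (hy : y ≠ 0) :
    ∫ s in Set.Ioi (0 : ℝ), s ^ (-α - 1) *
        (heatKernel s y * (1 - Real.exp (-(A * s)) * Real.cos (inner ℝ p y))) =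
      subordinationKernel α 0 y - subordinationKernel α A y * Real.cos (inner ℝ p y) := by
  rw [subordinationKernel, subordinationKernel, ← integral_mul_const, ← integral_sub
    (integrableOn_rpow_mul_exp_neg_mul_heatKernel hα le_rfl hy)
    ((integrableOn_rpow_mul_exp_neg_mul_heatKernel hα hA hy).mul_const _)]
  congr 1 with s
  simp only [zero_mul, neg_zero, Real.exp_zero]
  ring

variable [MeasurableSpace E] [BorelSpace E]

theorem measurable_subordinationKernel (α A : ℝ) :
    Measurable (subordinationKernel α A : E → ℝ) := by
  have h := measurable_heatKernel (E := E)
  exact (StronglyMeasurable.integral_prod_left' (Measurable.stronglyMeasurable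
    (f := fun z : ℝ × E => z.1 ^ (-α - 1) * (Real.exp (-(A * z.1)) * heatKernel z.1 z.2))
    (by fun_prop))).measurable

variable [FiniteDimensional ℝ E]

theorem integrableOn_subordinationKernel_zero (hα : 0 < α) (hε : 0 < ε) :
    IntegrableOn (subordinationKernel α 0 : E → ℝ) (Metric.closedBall 0 ε)ᶜ := by
  exact IntegrableOn.congr_fun
    ((integrableOn_norm_rpow_compl_closedBall (by linarith) hε).const_mul _)
    (fun y hy => (subordinationKernel_zero hα (ne_zero_of_mem_compl_closedBall hε.le hy)).symm)
    measurableSet_closedBall.compl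

theorem integrableOn_subordinationKernel (hα : 0 < α) (hA : 0 ≤ A) (hε : 0 < ε) :
    IntegrableOn (subordinationKernel α A : E → ℝ) (Metric.closedBall 0 ε)ᶜ := by
  refine (integrableOn_subordinationKernel_zero hα hε).mono'
    (measurable_subordinationKernel α A).aestronglyMeasurable ?_
  filter_upwards [ae_restrict_mem measurableSet_closedBall.compl] with y hy
  rw [Real.norm_of_nonneg (subordinationKernel_nonneg α A y)]
  exact subordinationKernel_le_zero hα hA (ne_zero_of_mem_compl_closedBall hε.le hy)

theorem setIntegral_subordinationKernel_zero (hα : 0 < α) (hε : 0 < ε) :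
    ∫ y in (Metric.closedBall (0 : E) ε)ᶜ, subordinationKernel α 0 y =
      ε ^ (-(2 * α)) * ∫ y in (Metric.closedBall (0 : E) 1)ᶜ, subordinationKernel α 0 y := by
  have h_eq (δ : ℝ) (hδ : 0 < δ) :
      ∫ y in (Metric.closedBall (0 : E) δ)ᶜ, subordinationKernel α 0 y = _ :=
    setIntegral_congr_fun measurableSet_closedBall.compl
      fun y hy => subordinationKernel_zero hα (ne_zero_of_mem_compl_closedBall hδ.le hy)
  rw [h_eq ε hε, h_eq 1 one_pos, integral_const_mul, integral_const_mul,
    setIntegral_norm_rpow_compl_closedBall hε, sub_add_cancel_left]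
  ring

theorem integrable_heatKernel_mul_one_sub (hs : 0 < s) (A : ℝ) (p : E) :
    Integrable fun y => heatKernel s y * (1 - Real.exp (-(A * s)) * Real.cos (inner ℝ p y)) := by
  refine ((integrable_heatKernel hs).sub
    ((integrable_heatKernel_mul_cos hs p).const_mul (Real.exp (-(A * s))))).congr
      (Eventually.of_forall fun y => ?_)
  simp only [Pi.sub_apply]
  ring

theorem integral_heatKernel_mul_one_sub (hs : 0 < s) (A : ℝ) (p : E) :
    ∫ y, heatKernel s y * (1 - Real.exp (-(A * s)) * Real.cos (inner ℝ p y)) =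
      1 - Real.exp (-((A + ‖p‖ ^ 2) * s)) := by
  calc ∫ y, heatKernel s y * (1 - Real.exp (-(A * s)) * Real.cos (inner ℝ p y))
      = ∫ y, (heatKernel s y - Real.exp (-(A * s)) * (heatKernel s y * Real.cos (inner ℝ p y))) :=
        integral_congr_ae (Eventually.of_forall fun y => by ring)
    _ = 1 - Real.exp (-(A * s)) * Real.exp (-(‖p‖ ^ 2 * s)) := by
        rw [integral_sub (integrable_heatKernel hs)
          ((integrable_heatKernel_mul_cos hs p).const_mul _), integral_const_mul,
          integral_heatKernel hs, integral_heatKernel_mul_cos hs]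
    _ = 1 - Real.exp (-((A + ‖p‖ ^ 2) * s)) := by rw [← Real.exp_add, add_mul, neg_add]

theorem one_sub_exp_neg_mul_cos_nonneg (hA : 0 ≤ A) (hs : 0 ≤ s) (t : ℝ) :
    0 ≤ 1 - Real.exp (-(A * s)) * Real.cos t := by
  have h_exp : Real.exp (-(A * s)) ≤ 1 := Real.exp_le_one_iff.2 (by nlinarith)
  nlinarith [Real.cos_le_one t, Real.exp_nonneg (-(A * s))]

-- Subtracting the undamped kernel makes the integrand nonnegative, so Tonelli's theorem applies.
theorem integrable_compensated_heatKernel (hα0 : 0 < α) (hα1 : α < 1) (hA : 0 ≤ A) (p : E) :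
    Integrable (fun z : ℝ × E => z.1 ^ (-α - 1) *
        (heatKernel z.1 z.2 * (1 - Real.exp (-(A * z.1)) * Real.cos (inner ℝ p z.2))))
      ((volume.restrict (Set.Ioi 0)).prod volume) := by
  have h_heat := measurable_heatKernel (E := E)
  rw [integrable_prod_iff (Measurable.aestronglyMeasurable (by fun_prop))]
  refine ⟨?_, ?_⟩
  · filter_upwards [ae_restrict_mem measurableSet_Ioi] with s hs
    exact (integrable_heatKernel_mul_one_sub hs A p).const_mul _
  · refine (integrableOn_rpow_mul_one_sub_exp_neg hα0 hα1
      (add_nonneg hA (sq_nonneg ‖p‖))).congr_fun (fun s (hs : 0 < s) => ?_) measurableSet_Ioi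
    have h_norm : ∀ y : E, ‖s ^ (-α - 1) * (heatKernel s y *
        (1 - Real.exp (-(A * s)) * Real.cos (inner ℝ p y)))‖ = s ^ (-α - 1) * (heatKernel s y *
        (1 - Real.exp (-(A * s)) * Real.cos (inner ℝ p y))) := fun y =>
      Real.norm_of_nonneg (mul_nonneg (by positivity) (mul_nonneg (heatKernel_nonneg hs.le y)
        (one_sub_exp_neg_mul_cos_nonneg hA hs.le _)))
    simp only [h_norm, integral_const_mul, integral_heatKernel_mul_one_sub hs]

variable [Nontrivial E]

theorem integral_compensated_heatKernel_ae_eq (hα : 0 < α) (hA : 0 ≤ A) (p : E) :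
    (fun y => ∫ s in Set.Ioi (0 : ℝ), s ^ (-α - 1) *
        (heatKernel s y * (1 - Real.exp (-(A * s)) * Real.cos (inner ℝ p y)))) =ᵐ[volume]
      fun y => subordinationKernel α 0 y - subordinationKernel α A y * Real.cos (inner ℝ p y) := by
  filter_upwards [compl_mem_ae_iff.2 (measure_singleton (0 : E))] with y hy
  exact integral_compensated_heatKernel hα hA p hy

theorem integrable_subordinationKernel_zero_sub (hα0 : 0 < α) (hα1 : α < 1) (hA : 0 ≤ A) (p : E) :
    Integrable fun y =>
      subordinationKernel α 0 y - subordinationKernel α A y * Real.cos (inner ℝ p y) :=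
  (integrable_compensated_heatKernel hα0 hα1 hA p).integral_prod_right.congr
    (integral_compensated_heatKernel_ae_eq hα0 hA p)

theorem integral_subordinationKernel_zero_sub (hα0 : 0 < α) (hα1 : α < 1) (hA : 0 < A) (p : E) :
    ∫ y, (subordinationKernel α 0 y - subordinationKernel α A y * Real.cos (inner ℝ p y)) =
      Real.Gamma (1 - α) / α * (A + ‖p‖ ^ 2) ^ α := by
  rw [← integral_congr_ae (integral_compensated_heatKernel_ae_eq hα0 hA.le p),
    ← integral_integral_swap (integrable_compensated_heatKernel hα0 hα1 hA.le p),
    ← integral_rpow_mul_one_sub_exp_neg hα0 hα1 (by positivity)]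
  refine setIntegral_congr_fun measurableSet_Ioi fun s hs => ?_
  simp only [integral_const_mul, integral_heatKernel_mul_one_sub hs]

theorem aecover_compl_closedBall :
    AECover (volume : Measure E) (𝓝[>] (0 : ℝ)) fun ε => (Metric.closedBall (0 : E) ε)ᶜ where
  ae_eventually_mem := by
    filter_upwards [compl_mem_ae_iff.2 (measure_singleton (0 : E))] with y hy
    filter_upwards [nhdsWithin_le_nhds (Iio_mem_nhds (norm_pos_iff.2 hy))] with ε hε
    simpa using hε
  measurableSet _ := measurableSet_closedBall.compl

/-- The convolution kernel of the fractional power `(A - Δ)^α` off the diagonal, for `0 < α < 1`. It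
is not integrable near the origin. -/
def fractionalKernel (α A : ℝ) (y : E) : ℝ :=
  -(α / Real.Gamma (1 - α)) * subordinationKernel α A y

end SubordinationKernel

/-! ### Convolution with even kernels -/

section CosTransform

variable {E : Type*} [NormedAddCommGroup E] [InnerProductSpace ℝ E] [MeasurableSpace E]
  [BorelSpace E] [FiniteDimensional ℝ E]

/-- The Fourier multiplier of convolution with an even kernel `κ`: its unnormalized Fourier
transform, written as a cosine integral. -/
def cosTransform (κ : E → ℝ) (p : E) : ℝ := ∫ y, κ y * Real.cos (inner ℝ p y)

theorem integrable_mul_cos {κ : E → ℝ} (hκ : Integrable κ) (p : E) :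
    Integrable fun y => κ y * Real.cos (inner ℝ p y) :=
  hκ.mul_bdd (c := 1) (by fun_prop) (Eventually.of_forall fun _ => Real.abs_cos_le_one _)

theorem norm_cosTransform_le {κ : E → ℝ} (hκ : Integrable κ) (p : E) :
    ‖cosTransform κ p‖ ≤ ∫ y, ‖κ y‖ := by
  refine norm_integral_le_of_norm_le hκ.norm (Eventually.of_forall fun y => ?_)
  rw [norm_mul]
  exact mul_le_of_le_one_right (norm_nonneg _) (Real.abs_cos_le_one _)

theorem continuous_cosTransform {κ : E → ℝ} (hκ : Integrable κ) : Continuous (cosTransform κ) := by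
  refine continuous_of_dominated (bound := fun y => ‖κ y‖)
    (fun p => (integrable_mul_cos hκ p).aestronglyMeasurable)
    (fun p => Eventually.of_forall fun y => ?_) hκ.norm
    (Eventually.of_forall fun y => by fun_prop)
  rw [norm_mul]
  exact mul_le_of_le_one_right (norm_nonneg _) (Real.abs_cos_le_one _)

theorem integral_mul_cexp_of_even {κ : E → ℝ} (hκ : Integrable κ) (h_even : ∀ y, κ (-y) = κ y)
    (p : E) :
    ∫ y, (κ y : ℂ) * Complex.exp (-(Complex.I * (inner ℝ p y : ℝ))) = (cosTransform κ p : ℂ) := by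
  have hi : Integrable fun y => (κ y : ℂ) * Complex.exp (-(Complex.I * (inner ℝ p y : ℝ))) :=
    hκ.ofReal.mul_bdd (c := 1) (by fun_prop)
      (Eventually.of_forall fun y => by simp [Complex.norm_exp])
  have h_sum : ∀ y, (κ y : ℂ) * Complex.exp (-(Complex.I * (inner ℝ p y : ℝ))) +
      (κ (-y) : ℂ) * Complex.exp (-(Complex.I * (inner ℝ p (-y) : ℝ))) =
        2 * ((κ y * Real.cos (inner ℝ p y) : ℝ) : ℂ) := by
    intro y
    rw [h_even, inner_neg_right]
    push_cast
    rw [Complex.cos]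
    ring_nf
  have h_add := integral_add hi hi.comp_neg
  simp only [h_sum] at h_add
  rw [integral_const_mul, integral_complex_ofReal, integral_neg_eq_self
    (fun y => (κ y : ℂ) * Complex.exp (-(Complex.I * (inner ℝ p y : ℝ)))), ← two_mul] at h_add
  exact (mul_left_cancel₀ two_ne_zero h_add).symm

variable {F : Type*} [NormedAddCommGroup F] [NormedSpace ℂ F] {κ : E → ℝ} {g : E → F}

theorem integrable_cosTransform_smul (hκ : Integrable κ) (hg : Integrable g) :
    Integrable fun p => (cosTransform κ p : ℂ) • g p := by
  have := continuous_cosTransform hκ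
  exact hg.bdd_smul (φ := fun p => (cosTransform κ p : ℂ)) (∫ y, ‖κ y‖)
    (Continuous.aestronglyMeasurable (by fun_prop)) (Eventually.of_forall fun p => by
      rw [Complex.norm_real]; exact norm_cosTransform_le hκ p)

theorem integrable_smul_waveTransform_sub (hκ : Integrable κ) (hg : Integrable g) (x : E) :
    Integrable fun u => κ u • waveTransform g (x - u) :=
  hκ.smul_bdd _ ((continuous_waveTransform hg).comp
    (continuous_const.sub continuous_id)).aestronglyMeasurable
    (Eventually.of_forall fun u => norm_waveTransform_le g (x - u))

theorem tendsto_waveTransform_of_dominated {ι : Type*} {l : Filter ι} [l.IsCountablyGenerated]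
    {φ : ι → E → ℝ} {σ b : E → ℝ} (hφ : ∀ᶠ i in l, Continuous (φ i))
    (hg : AEStronglyMeasurable g) (h_bound : ∀ᶠ i in l, ∀ p, ‖φ i p‖ ≤ b p)
    (hb : Integrable fun p => b p * ‖g p‖)
    (h_lim : ∀ p, Tendsto (fun i => φ i p) l (𝓝 (σ p))) (x : E) :
    Tendsto (fun i => waveTransform (fun p => (φ i p : ℂ) • g p) x) l
      (𝓝 (waveTransform (fun p => (σ p : ℂ) • g p) x)) := by
  refine (tendsto_integral_filter_of_dominated_convergence (fun p => b p * ‖g p‖) ?_ ?_ hb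
    (Eventually.of_forall fun p => ?_)).const_smul _
  · filter_upwards [hφ] with i hi
    exact (Continuous.aestronglyMeasurable (by fun_prop)).smul
      ((Continuous.aestronglyMeasurable (by fun_prop)).smul hg)
  · filter_upwards [h_bound] with i hi
    refine Eventually.of_forall fun p => ?_
    rw [norm_smul, mul_comm Complex.I, Complex.norm_exp_ofReal_mul_I, one_mul, norm_smul,
      Complex.norm_real]
    exact mul_le_mul_of_nonneg_right (hi p) (norm_nonneg _)
  · exact (((Complex.continuous_ofReal.tendsto _).comp (h_lim p)).smul_const _).const_smul _

theorem integral_smul_waveTransform_sub [CompleteSpace F] (hκ : Integrable κ)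
    (h_even : ∀ y, κ (-y) = κ y) (hg : Integrable g) (x : E) :
    ∫ u, κ u • waveTransform g (x - u) =
      waveTransform (fun p => (cosTransform κ p : ℂ) • g p) x := by
  have h_split (u p : E) : (κ u : ℂ) • Complex.exp (Complex.I * (inner ℝ p (x - u) : ℝ)) • g p =
      ((κ u : ℂ) * Complex.exp (-(Complex.I * (inner ℝ p u : ℝ)))) •
        Complex.exp (Complex.I * (inner ℝ p x : ℝ)) • g p := by
    rw [smul_smul, smul_smul, mul_assoc, ← Complex.exp_add, inner_sub_right]
    push_cast
    ring_nf
  have h_prod : Integrable (Function.uncurry fun u p : E =>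
      (κ u : ℂ) • Complex.exp (Complex.I * (inner ℝ p (x - u) : ℝ)) • g p)
      (volume.prod volume) := by
    refine ((Integrable.smul_prod (hκ.ofReal (𝕜 := ℂ)) hg).bdd_smul (φ := fun z : E × E =>
      Complex.exp (Complex.I * (inner ℝ z.2 (x - z.1) : ℝ))) 1
      (Continuous.aestronglyMeasurable (by fun_prop))
      (Eventually.of_forall fun z => by simp [Complex.norm_exp])).congr
        (Eventually.of_forall fun z => smul_comm _ _ _)
  simp only [waveTransform, smul_comm (κ _), integral_smul]
  congr 1
  simp only [← Complex.coe_smul (κ _), ← integral_smul]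
  rw [integral_integral_swap h_prod]
  congr 1 with p
  simp only [h_split]
  rw [integral_smul_const, integral_mul_cexp_of_even hκ h_even, smul_comm]

end CosTransform

/-! ### Finite parts of convolutions -/

section FinitePart

variable {n : ℕ} {F : Type*} [NormedAddCommGroup F] [NormedSpace ℂ F]
  {κ : Space n → ℝ} {g : Space n → F} {ε : ℝ}

/-- The combination `∑ᵢ cᵢ ε^{-(i+1)} + d log ε` of the terms that are discarded in a Hadamard
finite part. -/
def divergentPart {N : ℕ} (c : Fin N → ℝ) (d ε : ℝ) : ℝ :=
  ∑ i : Fin N, 1 / ε ^ ((i : ℕ) + 1) * c i + Real.log ε * d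

theorem indicator_smul_waveTransform_eq (κ : Space n → ℝ) (g : Space n → F) (x : Space n) (ε : ℝ) :
    {y | ε < ‖x - y‖}.indicator (fun y => κ (x - y) • waveTransform g y) =
      fun y => (fun u => (Metric.closedBall 0 ε)ᶜ.indicator κ u • waveTransform g (x - u))
        (x - y) := by
  funext y
  by_cases hy : ε < ‖x - y‖ <;> simp [Set.indicator, hy]

theorem integrableOn_smul_waveTransform (hκ : IntegrableOn κ (Metric.closedBall 0 ε)ᶜ)
    (hg : Integrable g) (x : Space n) :
    IntegrableOn (fun y => κ (x - y) • waveTransform g y) {y | ε < ‖x - y‖} := by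
  rw [← integrable_indicator_iff (measurableSet_lt measurable_const (by fun_prop)),
    indicator_smul_waveTransform_eq]
  exact (integrable_smul_waveTransform_sub
    (hκ.integrable_indicator measurableSet_closedBall.compl) hg x).comp_sub_left x

variable [CompleteSpace F]

theorem setIntegral_smul_waveTransform (hκ : IntegrableOn κ (Metric.closedBall 0 ε)ᶜ)
    (h_even : ∀ y, κ (-y) = κ y) (hg : Integrable g) (x : Space n) :
    ∫ y in {y | ε < ‖x - y‖}, κ (x - y) • waveTransform g y =
      waveTransform (fun p => (cosTransform ((Metric.closedBall 0 ε)ᶜ.indicator κ) p : ℂ) • g p)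
        x := by
  rw [← integral_indicator (measurableSet_lt measurable_const (by fun_prop)),
    indicator_smul_waveTransform_eq, integral_sub_left_eq_self
      (fun u => (Metric.closedBall 0 ε)ᶜ.indicator κ u • waveTransform g (x - u)) volume x]
  exact integral_smul_waveTransform_sub (hκ.integrable_indicator measurableSet_closedBall.compl)
    (fun y => by simp [Set.indicator, h_even]) hg x

theorem hasConvolution_waveTransform {σ b : Space n → ℝ} {N : ℕ} {c : Fin N → ℝ} {d : ℝ}
    (h_even : ∀ y, κ (-y) = κ y)
    (hκ : ∀ ε, 0 < ε → IntegrableOn κ (Metric.closedBall 0 ε)ᶜ) (hg : Integrable g)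
    (h_lim : ∀ p, Tendsto (fun ε => cosTransform ((Metric.closedBall 0 ε)ᶜ.indicator κ) p -
      divergentPart c d ε) (𝓝[>] 0) (𝓝 (σ p)))
    (h_bound : ∀ ε, 0 < ε → ∀ p,
      ‖cosTransform ((Metric.closedBall 0 ε)ᶜ.indicator κ) p - divergentPart c d ε‖ ≤ b p)
    (hb : Integrable fun p => b p * ‖g p‖) (x : Space n) :
    HasConvolution κ (waveTransform g) x (waveTransform (fun p => (σ p : ℂ) • g p) x) := by
  have hκ_ind (ε : ℝ) (hε : 0 < ε) : Integrable ((Metric.closedBall 0 ε)ᶜ.indicator κ) :=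
    (hκ ε hε).integrable_indicator measurableSet_closedBall.compl
  refine ⟨fun ε hε => integrableOn_smul_waveTransform (hκ ε hε) hg x, N,
    fun i => c i • waveTransform g x, d • waveTransform g x, ?_⟩
  refine (tendsto_waveTransform_of_dominated (b := b) ?_ hg.aestronglyMeasurable ?_ hb h_lim
    x).congr' ?_
  all_goals filter_upwards [self_mem_nhdsWithin] with ε (hε : 0 < ε)
  · exact (continuous_cosTransform (hκ_ind ε hε)).sub continuous_const
  · exact h_bound ε hε
  · rw [setIntegral_smul_waveTransform (hκ ε hε) h_even hg]
    simp only [smul_smul, ← Finset.sum_smul, ← add_smul]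
    rw [← divergentPart, ← Complex.coe_smul, ← waveTransform_const_smul,
      ← waveTransform_sub (integrable_cosTransform_smul (hκ_ind ε hε) hg) (hg.fun_smul _)]
    simp only [Complex.ofReal_sub, sub_smul]

end FinitePart

/-! ### The relativistic energy as a finite-part convolution -/

section FractionalPower

variable {E : Type*} [NormedAddCommGroup E] [InnerProductSpace ℝ E] [MeasurableSpace E]
  [BorelSpace E] [FiniteDimensional ℝ E] {α A ε : ℝ}

theorem integrableOn_fractionalKernel (hα : 0 < α) (hA : 0 ≤ A) (hε : 0 < ε) :
    IntegrableOn (fractionalKernel α A : E → ℝ) (Metric.closedBall 0 ε)ᶜ :=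
  (integrableOn_subordinationKernel hα hA hε).const_mul _

theorem setIntegral_fractionalKernel_zero (hα : 0 < α) (hε : 0 < ε) :
    ∫ y in (Metric.closedBall (0 : E) ε)ᶜ, fractionalKernel α 0 y =
      ε ^ (-(2 * α)) * ∫ y in (Metric.closedBall (0 : E) 1)ᶜ, fractionalKernel α 0 y := by
  simp only [fractionalKernel, integral_const_mul, setIntegral_subordinationKernel_zero hα hε]
  ring

theorem cosTransform_indicator_fractionalKernel_sub (hα : 0 < α) (hA : 0 ≤ A) (hε : 0 < ε)
    (p : E) :
    cosTransform ((Metric.closedBall 0 ε)ᶜ.indicator (fractionalKernel α A)) p -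
        ∫ y in (Metric.closedBall (0 : E) ε)ᶜ, fractionalKernel α 0 y =
      α / Real.Gamma (1 - α) * ∫ y in (Metric.closedBall (0 : E) ε)ᶜ,
        (subordinationKernel α 0 y - subordinationKernel α A y * Real.cos (inner ℝ p y)) := by
  have h_cos : cosTransform ((Metric.closedBall 0 ε)ᶜ.indicator (fractionalKernel α A)) p =
      ∫ y in (Metric.closedBall (0 : E) ε)ᶜ, fractionalKernel α A y * Real.cos (inner ℝ p y) := by
    rw [cosTransform, ← integral_indicator measurableSet_closedBall.compl]
    simp only [Set.indicator_mul_left]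
  have h_int : IntegrableOn (fun y => fractionalKernel α A y * Real.cos (inner ℝ p y))
      (Metric.closedBall (0 : E) ε)ᶜ :=
    (integrableOn_fractionalKernel hα hA hε).mul_bdd (c := 1) (by fun_prop)
      (Eventually.of_forall fun _ => Real.abs_cos_le_one _)
  rw [h_cos, ← integral_sub h_int (integrableOn_fractionalKernel hα le_rfl hε),
    ← integral_const_mul]
  congr 1 with y
  rw [fractionalKernel, fractionalKernel]
  ring

variable [Nontrivial E]

theorem subordinationKernel_zero_sub_ae_nonneg (hα : 0 < α) (hA : 0 ≤ A) (p : E) :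
    0 ≤ᵐ[volume] fun y =>
      subordinationKernel α 0 y - subordinationKernel α A y * Real.cos (inner ℝ p y) := by
  filter_upwards [compl_mem_ae_iff.2 (measure_singleton (0 : E))] with y hy
  exact sub_nonneg.2 <|
    (mul_le_of_le_one_right (subordinationKernel_nonneg α A y) (Real.cos_le_one _)).trans
      (subordinationKernel_le_zero hα hA hy)

theorem norm_cosTransform_indicator_fractionalKernel_sub_le (hα0 : 0 < α) (hα1 : α < 1)
    (hA : 0 < A) (hε : 0 < ε) (p : E) :
    ‖cosTransform ((Metric.closedBall 0 ε)ᶜ.indicator (fractionalKernel α A)) p -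
        ∫ y in (Metric.closedBall (0 : E) ε)ᶜ, fractionalKernel α 0 y‖ ≤ (A + ‖p‖ ^ 2) ^ α := by
  have hΓ : 0 < Real.Gamma (1 - α) := Real.Gamma_pos_of_pos (sub_pos.2 hα1)
  have h_nonneg := subordinationKernel_zero_sub_ae_nonneg hα0 hA.le p
  rw [cosTransform_indicator_fractionalKernel_sub hα0 hA.le hε,
    Real.norm_of_nonneg (mul_nonneg (by positivity) (integral_nonneg_of_ae
      (ae_restrict_of_ae h_nonneg)))]
  calc _ ≤ α / Real.Gamma (1 - α) * ∫ y,
        (subordinationKernel α 0 y - subordinationKernel α A y * Real.cos (inner ℝ p y)) := by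
        exact mul_le_mul_of_nonneg_left (setIntegral_le_integral
          (integrable_subordinationKernel_zero_sub hα0 hα1 hA.le p) h_nonneg) (by positivity)
    _ = (A + ‖p‖ ^ 2) ^ α := by
        rw [integral_subordinationKernel_zero_sub hα0 hα1 hA]
        field_simp

theorem tendsto_cosTransform_indicator_fractionalKernel_sub (hα0 : 0 < α) (hα1 : α < 1)
    (hA : 0 < A) (p : E) :
    Tendsto (fun ε => cosTransform ((Metric.closedBall 0 ε)ᶜ.indicator (fractionalKernel α A)) p -
      ∫ y in (Metric.closedBall (0 : E) ε)ᶜ, fractionalKernel α 0 y) (𝓝[>] 0)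
      (𝓝 ((A + ‖p‖ ^ 2) ^ α)) := by
  have hΓ : 0 < Real.Gamma (1 - α) := Real.Gamma_pos_of_pos (sub_pos.2 hα1)
  have h := ((aecover_compl_closedBall (E := E)).integral_tendsto_of_countably_generated
    (integrable_subordinationKernel_zero_sub hα0 hα1 hA.le p)).const_mul (α / Real.Gamma (1 - α))
  rw [integral_subordinationKernel_zero_sub hα0 hα1 hA, ← mul_assoc, div_mul_div_cancel₀ hΓ.ne',
    div_self hα0.ne', one_mul] at h
  refine h.congr' ?_
  filter_upwards [self_mem_nhdsWithin] with ε hε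
  exact (cosTransform_indicator_fractionalKernel_sub hα0 hA.le hε p).symm

end FractionalPower

section EnergyKernel

variable {n : ℕ} {m : ℝ}

theorem energy_eq_rpow (m : ℝ) (p : Space n) : energy m p = (m ^ 2 + ‖p‖ ^ 2) ^ (1 / 2 : ℝ) := by
  rw [energy, Real.sqrt_eq_rpow, add_comm]

theorem omegaTilde_eq_fractionalKernel (hm : 0 < m) {y : Space n} (hy : y ≠ 0) :
    omegaTilde m y = fractionalKernel (1 / 2) (m ^ 2) y := by
  have h_norm : 0 < ‖y‖ := norm_pos_iff.2 hy
  have h_order : (1 / 2 : ℝ) + (n : ℝ) / 2 = ((n : ℝ) + 1) / 2 := by ring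
  have h_ratio : (m / (‖y‖ / 2)) ^ (((n : ℝ) + 1) / 2) =
      2 ^ (((n : ℝ) + 1) / 2) * (m / ‖y‖) ^ (((n : ℝ) + 1) / 2) := by
    rw [← Real.mul_rpow (by norm_num) (by positivity)]
    congr 1
    field_simp
  have h_const : (1 / 2) / √π * (4 * π) ^ (-(n : ℝ) / 2) * 2 ^ (((n : ℝ) + 1) / 2) =
      (2 * π) ^ (-((n : ℝ) + 1) / 2) := by
    have h_sqrt : (1 / 2) / √π = (4 * π) ^ (-(1 / 2) : ℝ) := by
      rw [Real.rpow_neg (by positivity), ← Real.sqrt_eq_rpow, Real.sqrt_mul (by norm_num),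
        show (4 : ℝ) = 2 ^ 2 by norm_num, Real.sqrt_sq (by norm_num)]
      field_simp
    rw [h_sqrt, ← Real.rpow_add (by positivity), show 4 * π = 2 * (2 * π) by ring,
      Real.mul_rpow (by norm_num) (by positivity), mul_right_comm, ← Real.rpow_add (by norm_num),
      show -(1 / 2) + -(n : ℝ) / 2 + ((n : ℝ) + 1) / 2 = 0 by ring, Real.rpow_zero, one_mul,
      show -(1 / 2) + -(n : ℝ) / 2 = -((n : ℝ) + 1) / 2 by ring]
  rw [omegaTilde, fractionalKernel, subordinationKernel, setIntegral_congr_fun measurableSet_Ioi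
    fun s hs => rpow_mul_exp_neg_mul_heatKernel hs (1 / 2) (m ^ 2) y, integral_const_mul,
    integral_rpow_mul_exp_neg_sq_sub_sq_div hm (half_pos h_norm) (by positivity),
    finrank_euclideanSpace_fin, h_order, h_ratio, ← h_const, sub_half, Real.Gamma_one_half_eq,
    show 2 * m * (‖y‖ / 2) = m * ‖y‖ by ring]
  ring

theorem omegaTilde_neg (y : Space n) : omegaTilde m (-y) = omegaTilde m y := by
  rw [omegaTilde, omegaTilde, norm_neg]

theorem eqOn_omegaTilde_fractionalKernel (hm : 0 < m) {ε : ℝ} (hε : 0 ≤ ε) :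
    Set.EqOn (omegaTilde m : Space n → ℝ) (fractionalKernel (1 / 2) (m ^ 2))
      (Metric.closedBall 0 ε)ᶜ :=
  fun _ hy => omegaTilde_eq_fractionalKernel hm (ne_zero_of_mem_compl_closedBall hε hy)

theorem integrableOn_omegaTilde (hm : 0 < m) {ε : ℝ} (hε : 0 < ε) :
    IntegrableOn (omegaTilde m : Space n → ℝ) (Metric.closedBall 0 ε)ᶜ :=
  (integrableOn_fractionalKernel (by norm_num) (by positivity) hε).congr_fun
    (eqOn_omegaTilde_fractionalKernel hm hε.le).symm measurableSet_closedBall.compl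

/-- The coefficient of `1 / ε` in the divergent part of the convolution with `ω̃`. -/
def divergentCoeff (n : ℕ) : ℝ :=
  ∫ y in (Metric.closedBall (0 : Space n) 1)ᶜ, fractionalKernel (1 / 2) 0 y

theorem setIntegral_fractionalKernel_eq_divergentPart {ε : ℝ} (hε : 0 < ε) :
    ∫ y in (Metric.closedBall (0 : Space n) ε)ᶜ, fractionalKernel (1 / 2) 0 y =
      divergentPart (fun _ : Fin 1 => divergentCoeff n) 0 ε := by
  rw [setIntegral_fractionalKernel_zero (by norm_num) hε, divergentPart, divergentCoeff]
  simp [Real.rpow_neg_one]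

theorem cosTransform_indicator_omegaTilde_sub (hm : 0 < m) {ε : ℝ} (hε : 0 < ε) (p : Space n) :
    cosTransform ((Metric.closedBall 0 ε)ᶜ.indicator (omegaTilde m)) p -
        divergentPart (fun _ : Fin 1 => divergentCoeff n) 0 ε =
      cosTransform ((Metric.closedBall 0 ε)ᶜ.indicator (fractionalKernel (1 / 2) (m ^ 2))) p -
        ∫ y in (Metric.closedBall (0 : Space n) ε)ᶜ, fractionalKernel (1 / 2) 0 y := by
  rw [setIntegral_fractionalKernel_eq_divergentPart hε,
    Set.indicator_congr (eqOn_omegaTilde_fractionalKernel hm hε.le)]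

theorem hasConvolution_omegaTilde [Nontrivial (Space n)] (hm : 0 < m) {F : Type*}
    [NormedAddCommGroup F] [NormedSpace ℂ F] [CompleteSpace F] {g : Space n → F}
    (hg : Integrable g) (h_energy : Integrable fun p => (energy m p : ℂ) • g p) (x : Space n) :
    HasConvolution (omegaTilde m) (waveTransform g) x
      (waveTransform (fun p => (energy m p : ℂ) • g p) x) := by
  refine hasConvolution_waveTransform (b := energy m) omegaTilde_neg
    (fun ε hε => integrableOn_omegaTilde hm hε) hg (c := fun _ : Fin 1 => divergentCoeff n)
    (d := 0) (fun p => ?_) (fun ε hε p => ?_) ?_ x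
  · rw [energy_eq_rpow]
    refine (tendsto_cosTransform_indicator_fractionalKernel_sub one_half_pos one_half_lt_one
      (pow_pos hm 2) p).congr' ?_
    filter_upwards [self_mem_nhdsWithin] with ε hε
    exact (cosTransform_indicator_omegaTilde_sub hm hε p).symm
  · rw [cosTransform_indicator_omegaTilde_sub hm hε, energy_eq_rpow]
    exact norm_cosTransform_indicator_fractionalKernel_sub_le one_half_pos one_half_lt_one
      (pow_pos hm 2) hε p
  · refine h_energy.norm.congr (Eventually.of_forall fun p => ?_)
    have h_nonneg : 0 ≤ energy m p := Real.sqrt_nonneg _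
    simp only [norm_smul, Complex.norm_real, Real.norm_of_nonneg h_nonneg]

end EnergyKernel

/-! ### Rapidly decaying functions -/

section RapidDecay

variable {V F : Type*} [NormedAddCommGroup V] [NormedAddCommGroup F] {f g : V → F}

/-- Continuous functions that decay faster than any power. Unlike Schwartz functions they need not
be differentiable; the Fock-valued functions `p ↦ a(p) Ψ` are of this kind. -/
structure RapidDecay (f : V → F) : Prop where
  continuous : Continuous f
  decay : ∀ N : ℕ, ∃ C : ℝ, ∀ p, (1 + ‖p‖) ^ N * ‖f p‖ ≤ C

namespace RapidDecay

theorem zero : RapidDecay fun _ : V => (0 : F) :=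
  ⟨continuous_const, fun N => ⟨0, fun p => by simp⟩⟩

theorem add (hf : RapidDecay f) (hg : RapidDecay g) : RapidDecay fun p => f p + g p := by
  refine ⟨hf.continuous.add hg.continuous, fun N => ?_⟩
  obtain ⟨C, hC⟩ := hf.decay N
  obtain ⟨D, hD⟩ := hg.decay N
  refine ⟨C + D, fun p => ?_⟩
  calc (1 + ‖p‖) ^ N * ‖f p + g p‖ ≤ (1 + ‖p‖) ^ N * (‖f p‖ + ‖g p‖) := by
        gcongr; exact norm_add_le _ _
    _ ≤ C + D := by rw [mul_add]; exact add_le_add (hC p) (hD p)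

theorem norm_mul_norm (hf : RapidDecay f) : RapidDecay fun p => ‖p‖ * ‖f p‖ := by
  refine ⟨continuous_norm.mul hf.continuous.norm, fun N => ?_⟩
  obtain ⟨C, hC⟩ := hf.decay (N + 1)
  refine ⟨C, fun p => ?_⟩
  calc (1 + ‖p‖) ^ N * ‖‖p‖ * ‖f p‖‖ ≤ (1 + ‖p‖) ^ N * ((1 + ‖p‖) * ‖f p‖) := by
        rw [Real.norm_of_nonneg (by positivity)]; gcongr; linarith
    _ = (1 + ‖p‖) ^ (N + 1) * ‖f p‖ := by ring
    _ ≤ C := hC p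

theorem smul {𝕜 : Type*} [NormedSpace ℝ V] [NormedField 𝕜] [NormedSpace ℝ 𝕜] [NormedSpace 𝕜 F]
    (hf : RapidDecay f) {φ : V → 𝕜} (hφ : φ.HasTemperateGrowth) :
    RapidDecay fun p => φ p • f p := by
  refine ⟨hφ.1.continuous.smul hf.continuous, fun N => ?_⟩
  obtain ⟨k, C, hφC⟩ := hφ.2 0
  obtain ⟨D, hD⟩ := hf.decay (N + k)
  simp only [norm_iteratedFDeriv_zero] at hφC
  have hC : 0 ≤ C := by simpa using (norm_nonneg _).trans (hφC 0)
  refine ⟨C * D, fun p => ?_⟩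
  rw [norm_smul]
  calc (1 + ‖p‖) ^ N * (‖φ p‖ * ‖f p‖) ≤ (1 + ‖p‖) ^ N * (C * (1 + ‖p‖) ^ k * ‖f p‖) := by
        gcongr; exact hφC p
    _ = C * ((1 + ‖p‖) ^ (N + k) * ‖f p‖) := by ring
    _ ≤ C * D := by gcongr; exact hD p

theorem memLp [MeasurableSpace V] [OpensMeasurableSpace V] [SecondCountableTopology V]
    (hf : RapidDecay f) (r : ℝ≥0∞) (μ : Measure V) [hμ : μ.HasTemperateGrowth] : MemLp f r μ := by
  obtain ⟨N, hN⟩ := hμ.exists_eLpNorm_lt_top r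
  obtain ⟨C, hC⟩ := hf.decay N
  have h_weight : MemLp (fun p : V => (1 + ‖p‖) ^ (-(N : ℝ))) r μ :=
    ⟨Measurable.aestronglyMeasurable (by fun_prop), hN⟩
  refine h_weight.of_le_mul (c := C) hf.continuous.aestronglyMeasurable
    (Eventually.of_forall fun p => ?_)
  rw [Real.norm_of_nonneg (by positivity), Real.rpow_neg (by positivity), Real.rpow_natCast,
    ← div_eq_mul_inv, le_div_iff₀ (by positivity), mul_comm]
  exact hC p

theorem integrable [MeasurableSpace V] [OpensMeasurableSpace V] [SecondCountableTopology V]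
    (hf : RapidDecay f) (μ : Measure V) [μ.HasTemperateGrowth] : Integrable f μ :=
  memLp_one_iff_integrable.1 (hf.memLp 1 μ)

end RapidDecay

end RapidDecay

/-! ### Symbols of temperate growth -/

section Symbols

variable {n : ℕ} {m : ℝ}

theorem energy_pos (hm : 0 < m) (p : Space n) : 0 < energy m p := hm.trans_le (le_energy p)

theorem hasTemperateGrowth_energy_rpow (hm : 0 < m) (r : ℝ) :
    (fun p : Space n => energy m p ^ r).HasTemperateGrowth := by
  have h_eq : (fun p : Space n => energy m p ^ r) =
      fun p => m ^ r * (1 + ‖(m⁻¹ • ContinuousLinearMap.id ℝ (Space n)) p‖ ^ 2) ^ (r / 2) := by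
    funext p
    have h_sq : ‖p‖ ^ 2 + m ^ 2 =
        m ^ 2 * (1 + ‖(m⁻¹ • ContinuousLinearMap.id ℝ (Space n)) p‖ ^ 2) := by
      simp only [smul_apply, ContinuousLinearMap.id_apply, norm_smul, norm_inv,
        Real.norm_of_nonneg hm.le]
      field_simp
      ring
    rw [energy, h_sq, Real.sqrt_mul (by positivity), Real.sqrt_sq hm.le, Real.sqrt_eq_rpow,
      Real.mul_rpow hm.le (by positivity), ← Real.rpow_mul (by positivity), one_div_mul_eq_div]
  rw [h_eq]
  exact (Function.HasTemperateGrowth.const _).mul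
    ((Function.hasTemperateGrowth_one_add_norm_sq_rpow (Space n) (r / 2)).comp
      (ContinuousLinearMap.hasTemperateGrowth _))

theorem hasTemperateGrowth_covMomentum (hm : 0 < m) (μ : Fin (n + 1)) :
    (fun p : Space n => covMomentum m p μ).HasTemperateGrowth := by
  cases μ using Fin.cases with
  | zero =>
    simpa only [covMomentum, Fin.cons_zero, Real.rpow_one] using
      hasTemperateGrowth_energy_rpow (n := n) hm 1
  | succ j =>
    simp only [covMomentum, Fin.cons_succ]
    exact (-(EuclideanSpace.proj j : Space n →L[ℝ] ℝ)).hasTemperateGrowth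

theorem hasTemperateGrowth_ofReal_covMomentum (hm : 0 < m) (μ : Fin (n + 1)) :
    (fun p : Space n => (covMomentum m p μ : ℂ)).HasTemperateGrowth :=
  Complex.ofRealCLM.hasTemperateGrowth.comp (hasTemperateGrowth_covMomentum hm μ)

end Symbols

/-! ### Decay in the sharp momentum -/

section Slices

theorem exists_norm_toLp_le {E F : Type*} [NormedAddCommGroup E] [NormedSpace ℝ E]
    [MeasurableSpace E] [OpensMeasurableSpace E] [SecondCountableTopology E]
    [NormedAddCommGroup F] [NormedSpace ℝ F] (r : ℝ≥0∞) (μ : Measure E)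
    [hμ : μ.HasTemperateGrowth] :
    ∃ (M : ℕ) (B : ℝ), ∀ (f : 𝓢(E, F)) (D : ℝ),
      (∀ q, (1 + ‖q‖) ^ M * ‖f q‖ ≤ D) → ‖f.toLp r μ‖ ≤ D * B := by
  obtain ⟨M, hM⟩ := hμ.exists_eLpNorm_lt_top r
  refine ⟨M, (eLpNorm (fun x : E => (1 + ‖x‖) ^ (-(M : ℝ))) r μ).toReal, fun f D hD => ?_⟩
  have hD_nonneg : 0 ≤ D := (by positivity : 0 ≤ (1 + ‖(0 : E)‖) ^ M * ‖f 0‖).trans (hD 0)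
  rw [SchwartzMap.norm_toLp, ← ENNReal.toReal_ofReal hD_nonneg, ← ENNReal.toReal_mul]
  refine ENNReal.toReal_mono (ENNReal.mul_ne_top ENNReal.ofReal_ne_top hM.ne) ?_
  refine eLpNorm_le_mul_eLpNorm_of_ae_le_mul (Eventually.of_forall fun q => ?_) r
  rw [Real.norm_of_nonneg (by positivity), Real.rpow_neg (by positivity), Real.rpow_natCast,
    ← div_eq_mul_inv, le_div_iff₀ (by positivity), mul_comm]
  exact hD q

variable {V : Type*} [NormedAddCommGroup V] {n k : ℕ}

theorem norm_le_norm_cons_left (p : V) (q : Fin k → V) :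
    ‖p‖ ≤ ‖(Fin.cons p q : Fin (k + 1) → V)‖ := by
  simpa only [Fin.cons_zero] using norm_le_pi_norm (Fin.cons p q : Fin (k + 1) → V) 0

theorem norm_le_norm_cons_right (p : V) (q : Fin k → V) :
    ‖q‖ ≤ ‖(Fin.cons p q : Fin (k + 1) → V)‖ :=
  (pi_norm_le_iff_of_nonneg (norm_nonneg _)).2 fun i => by
    simpa only [Fin.cons_succ] using
      norm_le_pi_norm (Fin.cons p q : Fin (k + 1) → V) i.succ

theorem norm_cons_sub_cons_le (p p' : V) (q : Fin k → V) :
    ‖(Fin.cons p q : Fin (k + 1) → V) - Fin.cons p' q‖ ≤ ‖p - p'‖ := by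
  refine (pi_norm_le_iff_of_nonneg (norm_nonneg _)).2 fun i => ?_
  cases i using Fin.cases <;> simp

theorem convex_setOf_tail_eq [NormedSpace ℝ V] (q : Fin k → V) :
    Convex ℝ {z : Fin (k + 1) → V | Fin.tail z = q} :=
  (convex_singleton q).linear_preimage
    (LinearMap.pi fun i : Fin k => LinearMap.proj (R := ℝ) (φ := fun _ => V) i.succ)

theorem slice_apply (p : Space n) (f : symSchwartz n (k + 1)) (q : Fin k → Space n) :
    (slice k p f).1 q = f.1 (Fin.cons p q) :=
  rfl

theorem exists_pow_mul_norm_slice_le (f : symSchwartz n (k + 1)) (M N : ℕ) :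
    ∃ D : ℝ, ∀ p q, (1 + ‖p‖) ^ N * ((1 + ‖q‖) ^ M * ‖(slice k p f).1 q‖) ≤ D := by
  refine ⟨_, fun p q => le_trans ?_ (SchwartzMap.one_add_le_sup_seminorm_apply (𝕜 := ℝ)
    (m := (N + M, 0)) le_rfl le_rfl f.1 (Fin.cons p q))⟩
  rw [norm_iteratedFDeriv_zero, slice_apply, pow_add, mul_assoc]
  gcongr
  · exact norm_le_norm_cons_left p q
  · exact norm_le_norm_cons_right p q

theorem exists_pow_mul_norm_slice_sub_le (f : symSchwartz n (k + 1)) (M : ℕ) :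
    ∃ D : ℝ, ∀ p p' q,
      (1 + ‖q‖) ^ M * ‖(slice k p f - slice k p' f).1 q‖ ≤ D * ‖p - p'‖ := by
  obtain ⟨D, hD⟩ : ∃ D : ℝ, ∀ z, (1 + ‖z‖) ^ M * ‖fderiv ℝ f.1 z‖ ≤ D := by
    refine ⟨_, fun z => le_trans (le_of_eq ?_) (SchwartzMap.one_add_le_sup_seminorm_apply (𝕜 := ℝ)
      (m := (M, 1)) le_rfl le_rfl f.1 z)⟩
    rw [norm_iteratedFDeriv_one]
  refine ⟨D, fun p p' q => ?_⟩
  have hD_nonneg : 0 ≤ D := le_trans (by positivity) (hD 0)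
  have h_fderiv : ∀ z ∈ {z : Fin (k + 1) → Space n | Fin.tail z = q},
      ‖fderiv ℝ f.1 z‖ ≤ D / (1 + ‖q‖) ^ M := by
    rintro z rfl
    have h_tail : ‖Fin.tail z‖ ≤ ‖z‖ := by
      simpa only [Fin.cons_self_tail] using norm_le_norm_cons_right (z 0) (Fin.tail z)
    rw [le_div_iff₀ (by positivity), mul_comm]
    refine le_trans ?_ (hD z)
    gcongr
  have h_mvt : ‖f.1 (Fin.cons p q) - f.1 (Fin.cons p' q)‖ ≤
      D / (1 + ‖q‖) ^ M * ‖(Fin.cons p q : Fin (k + 1) → Space n) - Fin.cons p' q‖ :=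
    (convex_setOf_tail_eq q).norm_image_sub_le_of_norm_fderiv_le (𝕜 := ℝ)
      (fun z _ => f.1.differentiableAt) h_fderiv (Fin.tail_cons _ _) (Fin.tail_cons _ _)
  calc (1 + ‖q‖) ^ M * ‖(slice k p f - slice k p' f).1 q‖
      = (1 + ‖q‖) ^ M * ‖f.1 (Fin.cons p q) - f.1 (Fin.cons p' q)‖ := rfl
    _ ≤ (1 + ‖q‖) ^ M * (D / (1 + ‖q‖) ^ M * ‖p - p'‖) := by
        gcongr
        refine h_mvt.trans ?_
        gcongr
        exact norm_cons_sub_cons_le p p' q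
    _ = D * ‖p - p'‖ := by field_simp

end Slices

section Annihilation

variable {n k : ℕ}

theorem annihilationCov_single_succ (f : symSchwartz n (k + 1)) (p : Space n) :
    annihilationCov p (DFinsupp.single (k + 1) f : Dom n) =
      ((Real.sqrt (k + 1) : ℝ) : ℂ) • DFinsupp.single k (slice k p f) := by
  rw [← DFinsupp.single_smul]
  refine DFinsupp.ext fun l => ?_
  change ((Real.sqrt (l + 1) : ℝ) : ℂ) • slice l p ((DFinsupp.single (k + 1) f : Dom n) (l + 1)) = _
  by_cases h : k = l
  · subst h
    simp only [DFinsupp.single_eq_same]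
  · rw [DFinsupp.single_eq_of_ne (by omega), DFinsupp.single_eq_of_ne (Ne.symm h), map_zero,
      smul_zero]

theorem annihilationCov_single_zero (f : symSchwartz n 0) (p : Space n) :
    annihilationCov p (DFinsupp.single 0 f : Dom n) = 0 := by
  refine DFinsupp.ext fun l => ?_
  change ((Real.sqrt (l + 1) : ℝ) : ℂ) • slice l p ((DFinsupp.single 0 f : Dom n) (l + 1)) = 0
  rw [DFinsupp.single_eq_of_ne l.succ_ne_zero, map_zero, smul_zero]

variable {m : ℝ} [hm : Fact (0 < m)]

theorem coe_toKParticle (f : symSchwartz n k) :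
    (toKParticle n m k f : Lp ℂ 2 (kMeasure n m k)) = f.1.toLp 2 (kMeasure n m k) :=
  rfl

theorem toFock_single (f : symSchwartz n k) :
    toFock m (DFinsupp.single k f : Dom n) =
      (lp.single 2 k (toKParticle n m k f) : lp (fun k : ℕ => kParticleSpace n m k) 2) := by
  refine Subtype.ext (funext fun l => ?_)
  change toKParticle n m l ((DFinsupp.single k f : Dom n) l) =
    (Pi.single k (toKParticle n m k f) : ∀ l, kParticleSpace n m l) l
  by_cases h : k = l
  · subst h
    rw [DFinsupp.single_eq_same, Pi.single_eq_same]
  · rw [DFinsupp.single_eq_of_ne (Ne.symm h), Pi.single_eq_of_ne (Ne.symm h), map_zero]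

theorem norm_toFock_single (f : symSchwartz n k) :
    ‖toFock m (DFinsupp.single k f : Dom n)‖ = ‖f.1.toLp 2 (kMeasure n m k)‖ := by
  rw [toFock_single]
  exact lp.norm_single (E := fun k : ℕ => kParticleSpace n m k) two_pos k (toKParticle n m k f)

theorem rapidDecay_toFock_single_slice (f : symSchwartz n (k + 1)) :
    RapidDecay fun p => toFock m (DFinsupp.single k (slice k p f)) := by
  obtain ⟨M, B, hB⟩ := exists_norm_toLp_le (F := ℂ) 2 (kMeasure n m k)
  refine ⟨?_, fun N => ?_⟩
  · obtain ⟨D, hD⟩ := exists_pow_mul_norm_slice_sub_le f M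
    refine (LipschitzWith.of_dist_le' (K := D * B) fun p p' => ?_).continuous
    rw [dist_eq_norm, dist_eq_norm, ← map_sub, ← DFinsupp.single_sub, norm_toFock_single,
      mul_right_comm]
    exact hB _ _ (hD p p')
  · obtain ⟨D, hD⟩ := exists_pow_mul_norm_slice_le f M N
    refine ⟨D * B, fun p => ?_⟩
    rw [norm_toFock_single, ← le_div_iff₀' (by positivity), mul_div_right_comm]
    refine hB _ _ fun q => ?_
    rw [le_div_iff₀' (by positivity)]
    exact hD p q

theorem rapidDecay_toFock_annihilationCov (Ψ : Dom n) :
    RapidDecay fun p => toFock m (annihilationCov p Ψ) := by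
  induction Ψ using DFinsupp.induction with
  | h0 => simpa only [map_zero] using RapidDecay.zero
  | ha k f Ψ _ _ ih =>
    simp only [map_add]
    refine RapidDecay.add ?_ ih
    cases k with
    | zero => simpa only [annihilationCov_single_zero, map_zero] using RapidDecay.zero
    | succ k =>
      simp only [annihilationCov_single_succ, map_smul]
      exact (rapidDecay_toFock_single_slice f).smul (.const _)

theorem rapidDecay_annihilation (Ψ : Dom n) : RapidDecay fun p => annihilation m p Ψ := by
  have h_norm : ∀ p : Space n,
      1 / Real.sqrt (2 * energy m p) = (Real.sqrt 2)⁻¹ * energy m p ^ (-(1 / 2) : ℝ) := fun p => by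
    rw [Real.sqrt_mul two_pos.le, one_div, mul_inv, Real.rpow_neg (energy_pos hm.out p).le,
      ← Real.sqrt_eq_rpow]
  have h_growth : (fun p : Space n =>
      ((1 / Real.sqrt (2 * energy m p) : ℝ) : ℂ)).HasTemperateGrowth := by
    simp only [h_norm]
    exact Complex.ofRealCLM.hasTemperateGrowth.comp
      ((Function.HasTemperateGrowth.const _).mul (hasTemperateGrowth_energy_rpow hm.out _))
  exact (rapidDecay_toFock_annihilationCov Ψ).smul h_growth

end Annihilation

/-! ### Second quantization -/

section ProductMeasures

theorem integral_pi_cons {E F : Type*} [MeasurableSpace E] [NormedAddCommGroup F] [NormedSpace ℝ F]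
    (ν : Measure E) [SigmaFinite ν] {k : ℕ} {h : (Fin (k + 1) → E) → F}
    (h_int : Integrable h (Measure.pi fun _ => ν)) :
    ∫ z, h z ∂Measure.pi (fun _ => ν) =
      ∫ p, ∫ q, h (Fin.cons p q) ∂Measure.pi (fun _ => ν) ∂ν := by
  have h_cons : ∀ z : E × (Fin k → E),
      (MeasurableEquiv.piFinSuccAbove (fun _ : Fin (k + 1) => E) 0).symm z =
        Fin.cons z.1 z.2 := fun z => by
    simp only [MeasurableEquiv.piFinSuccAbove, Fin.insertNthEquiv_zero]
    rfl
  have h_mp := (measurePreserving_piFinSuccAbove (fun _ : Fin (k + 1) => ν) 0).symm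
  have h_int' := (h_mp.integrable_comp_emb (MeasurableEquiv.measurableEmbedding _)).2 h_int
  simp only [Function.comp_def, h_cons] at h_int'
  rw [← h_mp.integral_comp']
  simp only [h_cons]
  exact integral_prod _ h_int'

theorem integrable_inner_of_memLp {α 𝕜 F : Type*} [RCLike 𝕜] [MeasurableSpace α] {μ : Measure α}
    [NormedAddCommGroup F] [InnerProductSpace 𝕜 F] {f g : α → F} (hf : MemLp f 2 μ)
    (hg : MemLp g 2 μ) : Integrable (fun x => inner 𝕜 (f x) (g x)) μ :=
  (L2.integrable_inner (𝕜 := 𝕜) (hf.toLp f) (hg.toLp g)).congr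
    (hf.coeFn_toLp.comp₂ (inner 𝕜) hg.coeFn_toLp)

variable {n k : ℕ} {m : ℝ}

theorem integral_comp_perm {F : Type*} [NormedAddCommGroup F] [NormedSpace ℝ F]
    (σ : Equiv.Perm (Fin k)) (h : (Fin k → Space n) → F) :
    ∫ q, h (q ∘ σ) ∂kMeasure n m k = ∫ q, h q ∂kMeasure n m k :=
  (measurePreserving_perm n m k σ).integral_comp
    (MeasurableEquiv.arrowCongr' σ.symm (.refl _)).measurableEmbedding h

theorem integral_apply_mul_inner_eq (φ : Space n → ℂ) (f g : symSchwartz n (k + 1))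
    (i : Fin (k + 1)) :
    ∫ q, φ (q i) * inner ℂ (f.1 q) (g.1 q) ∂kMeasure n m (k + 1) =
      ∫ q, φ (q 0) * inner ℂ (f.1 q) (g.1 q) ∂kMeasure n m (k + 1) := by
  rw [← integral_comp_perm (Equiv.swap 0 i)]
  simp only [f.2 _ _, g.2 _ _, Function.comp_apply, Equiv.swap_apply_right]

theorem integral_massShellMeasure {F : Type*} [NormedAddCommGroup F] [NormedSpace ℝ F]
    (hm : 0 < m) (h : Space n → F) :
    ∫ p, h p ∂massShellMeasure n m = ∫ p, (1 / (2 * energy m p)) • h p := by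
  have h_cont := continuous_energy (n := n) m
  rw [massShellMeasure, integral_withDensity_eq_integral_toReal_smul (by fun_prop)
    (Eventually.of_forall fun p => ENNReal.ofReal_lt_top)]
  refine integral_congr_ae (Eventually.of_forall fun p => ?_)
  have := energy_pos hm p
  dsimp only
  rw [ENNReal.toReal_ofReal (by positivity)]

end ProductMeasures

section SecondQuantization

variable {n k l : ℕ} {φ : Space n → ℂ}

/-- The function `∑ᵢ φ(pᵢ)` of `k` momenta, the `k`-particle symbol of the second quantization of
multiplication by `φ`. -/
def totalSymbol (k : ℕ) (φ : Space n → ℂ) (q : Fin k → Space n) : ℂ :=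
  ∑ i, φ (q i)

theorem totalSymbol_comp_perm (σ : Equiv.Perm (Fin k)) (q : Fin k → Space n) :
    totalSymbol k φ (q ∘ σ) = totalSymbol k φ q :=
  Equiv.sum_comp σ fun i => φ (q i)

theorem hasTemperateGrowth_comp_apply (hφ : φ.HasTemperateGrowth) (i : Fin k) :
    (fun q : Fin k → Space n => φ (q i)).HasTemperateGrowth :=
  hφ.comp (ContinuousLinearMap.proj (R := ℝ) (φ := fun _ : Fin k => Space n) i).hasTemperateGrowth

theorem hasTemperateGrowth_totalSymbol (k : ℕ) (hφ : φ.HasTemperateGrowth) :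
    (totalSymbol k φ).HasTemperateGrowth :=
  Function.HasTemperateGrowth.sum fun i _ => hasTemperateGrowth_comp_apply hφ i

/-- Multiplication by `∑ᵢ φ(pᵢ)` on the symmetric Schwartz functions of `k` momenta. -/
def mulTotalSymbol (hφ : φ.HasTemperateGrowth) (k : ℕ) : symSchwartz n k →ₗ[ℂ] symSchwartz n k :=
  ((SchwartzMap.smulLeftCLM ℂ (totalSymbol k φ)).toLinearMap ∘ₗ
    (symSchwartz n k).subtype).codRestrict (symSchwartz n k) (by
      intro f σ q
      have h_growth := hasTemperateGrowth_totalSymbol k hφ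
      simp only [LinearMap.comp_apply, Submodule.subtype_apply, ContinuousLinearMap.coe_coe]
      rw [SchwartzMap.smulLeftCLM_apply_apply h_growth,
        SchwartzMap.smulLeftCLM_apply_apply h_growth, totalSymbol_comp_perm, f.2 σ q])

theorem mulTotalSymbol_apply (hφ : φ.HasTemperateGrowth) (f : symSchwartz n k)
    (q : Fin k → Space n) : (mulTotalSymbol hφ k f).1 q = totalSymbol k φ q * f.1 q :=
  SchwartzMap.smulLeftCLM_apply_apply (hasTemperateGrowth_totalSymbol k hφ) f.1 q

theorem mulTotalSymbol_zero (hφ : φ.HasTemperateGrowth) (f : symSchwartz n 0) :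
    mulTotalSymbol hφ 0 f = 0 := by
  refine Subtype.ext (SchwartzMap.ext fun q => ?_)
  rw [mulTotalSymbol_apply, totalSymbol, Finset.univ_eq_empty, Finset.sum_empty, zero_mul]
  rfl

variable {m : ℝ} [hm : Fact (0 < m)]

variable (m) in
/-- The second quantization `dΓ(φ) = ∫ dⁿp φ(p) a*(p) a(p)` of multiplication by `φ`. -/
def secondQuantization (hφ : φ.HasTemperateGrowth) : Dom n →ₗ[ℂ] Fock n m :=
  toFock m ∘ₗ DFinsupp.mapRange.linearMap (mulTotalSymbol hφ)

theorem secondQuantization_single (hφ : φ.HasTemperateGrowth) (f : symSchwartz n k) :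
    secondQuantization m hφ (DFinsupp.single k f) =
      toFock m (DFinsupp.single k (mulTotalSymbol hφ k f)) := by
  simp [secondQuantization]

theorem inner_toFock_single_left (f : symSchwartz n k)
    (v : lp (fun k : ℕ => kParticleSpace n m k) 2) :
    inner ℂ (toFock m (DFinsupp.single k f)) (show Fock n m from v) =
      inner ℂ (toKParticle n m k f) (v k) := by
  rw [toFock_single]
  exact lp.inner_single_left (𝕜 := ℂ) (G := fun k : ℕ => kParticleSpace n m k) k
    (toKParticle n m k f) v

theorem inner_toFock_single_same (f g : symSchwartz n k) :
    inner ℂ (toFock m (DFinsupp.single k f)) (toFock m (DFinsupp.single k g)) =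
      ∫ q, inner ℂ (f.1 q) (g.1 q) ∂kMeasure n m k := by
  rw [toFock_single g]
  refine (inner_toFock_single_left f _).trans ?_
  rw [lp.single_apply_self, Submodule.coe_inner, coe_toKParticle, coe_toKParticle]
  exact SchwartzMap.inner_toL2_toL2_eq f.1 g.1 (kMeasure n m k)

theorem inner_toFock_single_of_ne (h : k ≠ l) (f : symSchwartz n k) (g : symSchwartz n l) :
    inner ℂ (toFock m (DFinsupp.single k f)) (toFock m (DFinsupp.single l g)) = 0 := by
  rw [toFock_single g]
  refine (inner_toFock_single_left f _).trans ?_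
  rw [lp.single_apply_ne _ _ _ h, inner_zero_right]

theorem annihilation_single_zero (f : symSchwartz n 0) (p : Space n) :
    annihilation m p (DFinsupp.single 0 f) = 0 := by
  rw [annihilation, LinearMap.smul_apply, LinearMap.comp_apply, annihilationCov_single_zero,
    map_zero, smul_zero]

theorem annihilation_single_succ (f : symSchwartz n (k + 1)) (p : Space n) :
    annihilation m p (DFinsupp.single (k + 1) f) =
      ((1 / Real.sqrt (2 * energy m p) * Real.sqrt (k + 1) : ℝ) : ℂ) •
        toFock m (DFinsupp.single k (slice k p f)) := by
  rw [annihilation, LinearMap.smul_apply, LinearMap.comp_apply, annihilationCov_single_succ,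
    map_smul, smul_smul, Complex.ofReal_mul]

theorem inner_annihilation_single_succ (f g : symSchwartz n (k + 1)) (p : Space n) :
    inner ℂ (annihilation m p (DFinsupp.single (k + 1) f))
      (annihilation m p (DFinsupp.single (k + 1) g)) =
    ((1 / (2 * energy m p) * (k + 1) : ℝ) : ℂ) *
      ∫ q, inner ℂ (f.1 (Fin.cons p q)) (g.1 (Fin.cons p q)) ∂kMeasure n m k := by
  have h_sq : (1 / Real.sqrt (2 * energy m p) * Real.sqrt (k + 1)) *
      (1 / Real.sqrt (2 * energy m p) * Real.sqrt (k + 1)) = 1 / (2 * energy m p) * (k + 1) := by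
    have := energy_pos hm.out p
    rw [mul_mul_mul_comm, div_mul_div_comm, one_mul, Real.mul_self_sqrt (by positivity),
      Real.mul_self_sqrt (by positivity)]
  rw [annihilation_single_succ, annihilation_single_succ, inner_smul_left, inner_smul_right,
    Complex.conj_ofReal, ← mul_assoc, ← Complex.ofReal_mul, h_sq, inner_toFock_single_same]
  rfl

theorem inner_annihilation_single_of_ne (h : k ≠ l) (f : symSchwartz n k) (g : symSchwartz n l)
    (p : Space n) :
    inner ℂ (annihilation m p (DFinsupp.single k f)) (annihilation m p (DFinsupp.single l g)) =
      0 := by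
  cases k with
  | zero => rw [annihilation_single_zero, inner_zero_left]
  | succ k =>
    cases l with
    | zero => rw [annihilation_single_zero, inner_zero_right]
    | succ l =>
      rw [annihilation_single_succ, annihilation_single_succ, inner_smul_left, inner_smul_right,
        inner_toFock_single_of_ne (by omega), mul_zero, mul_zero]

theorem integrable_apply_mul_inner (hφ : φ.HasTemperateGrowth) (f g : 𝓢(Fin k → Space n, ℂ))
    (i : Fin k) : Integrable (fun q => φ (q i) * inner ℂ (f q) (g q)) (kMeasure n m k) := by
  have h_int := integrable_inner_of_memLp (𝕜 := ℂ) (f.memLp 2 (kMeasure n m k))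
    ((SchwartzMap.smulLeftCLM ℂ (fun q : Fin k → Space n => φ (q i)) g).memLp 2 (kMeasure n m k))
  simpa only [SchwartzMap.smulLeftCLM_apply_apply (hasTemperateGrowth_comp_apply hφ i),
    inner_smul_right] using h_int

theorem inner_secondQuantization_single_same (hφ : φ.HasTemperateGrowth) (f g : symSchwartz n k) :
    inner ℂ (toFock m (DFinsupp.single k f)) (secondQuantization m hφ (DFinsupp.single k g)) =
      ∑ i, ∫ q, φ (q i) * inner ℂ (f.1 q) (g.1 q) ∂kMeasure n m k := by
  rw [secondQuantization_single, inner_toFock_single_same,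
    ← integral_finsetSum _ fun i _ => integrable_apply_mul_inner hφ f.1 g.1 i]
  refine integral_congr_ae (Eventually.of_forall fun q => ?_)
  dsimp only
  rw [mulTotalSymbol_apply, ← smul_eq_mul, inner_smul_right, totalSymbol, Finset.sum_mul]

theorem inner_secondQuantization_single_succ (hφ : φ.HasTemperateGrowth)
    (f g : symSchwartz n (k + 1)) :
    inner ℂ (toFock m (DFinsupp.single (k + 1) f))
        (secondQuantization m hφ (DFinsupp.single (k + 1) g)) =
      ∫ p, inner ℂ (annihilation m p (DFinsupp.single (k + 1) f))
        (φ p • annihilation m p (DFinsupp.single (k + 1) g)) := by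
  rw [inner_secondQuantization_single_same]
  simp only [integral_apply_mul_inner_eq]
  rw [Finset.sum_const, Finset.card_univ, Fintype.card_fin,
    integral_pi_cons _ (integrable_apply_mul_inner hφ f.1 g.1 0),
    integral_massShellMeasure hm.out, nsmul_eq_mul, ← integral_const_mul]
  refine integral_congr_ae (Eventually.of_forall fun p => ?_)
  simp only [inner_smul_right, inner_annihilation_single_succ, Fin.cons_zero, integral_const_mul,
    Complex.real_smul]
  push_cast
  ring

theorem inner_secondQuantization_single (hφ : φ.HasTemperateGrowth) (f : symSchwartz n k)
    (g : symSchwartz n l) :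
    inner ℂ (toFock m (DFinsupp.single k f)) (secondQuantization m hφ (DFinsupp.single l g)) =
      ∫ p, inner ℂ (annihilation m p (DFinsupp.single k f))
        (φ p • annihilation m p (DFinsupp.single l g)) := by
  by_cases hkl : k = l
  · subst hkl
    cases k with
    | zero =>
      simp only [secondQuantization_single, mulTotalSymbol_zero, DFinsupp.single_zero, map_zero,
        annihilation_single_zero, smul_zero, inner_zero_right, integral_zero]
    | succ k => exact inner_secondQuantization_single_succ hφ f g
  · simp only [secondQuantization_single, inner_toFock_single_of_ne hkl, inner_smul_right,
      inner_annihilation_single_of_ne hkl, mul_zero, integral_zero]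

end SecondQuantization

section OperatorIntegrals

variable {n : ℕ} {m : ℝ} [Fact (0 < m)] {φ : Space n → ℂ}

theorem isOperatorIntegral_of_single {T : Dom n →ₗ[ℂ] Fock n m}
    {A B : Space n → Dom n →ₗ[ℂ] Fock n m}
    (h_int : ∀ Φ Ψ : Dom n, Integrable fun y => inner ℂ (A y Φ) (B y Ψ))
    (h_single : ∀ (k l : ℕ) (f : symSchwartz n k) (g : symSchwartz n l),
      inner ℂ (toFock m (DFinsupp.single k f)) (T (DFinsupp.single l g)) =
        ∫ y, inner ℂ (A y (DFinsupp.single k f)) (B y (DFinsupp.single l g))) :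
    IsOperatorIntegral T (fun y => A y) (fun y => B y) := by
  refine fun Φ Ψ => ⟨h_int Φ Ψ, ?_⟩
  induction Φ using DFinsupp.induction with
  | h0 => simp only [map_zero, inner_zero_left, integral_zero]
  | ha k f Φ _ _ ihΦ =>
    simp only [map_add, inner_add_left]
    rw [integral_add (h_int _ _) (h_int _ _), ihΦ]
    congr 1
    clear ihΦ
    induction Ψ using DFinsupp.induction with
    | h0 => simp only [map_zero, inner_zero_right, integral_zero]
    | ha l g Ψ _ _ ihΨ =>
      simp only [map_add, inner_add_right]
      rw [integral_add (h_int _ _) (h_int _ _), ihΨ, h_single]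

theorem isOperatorIntegral_secondQuantization (hφ : φ.HasTemperateGrowth) :
    IsOperatorIntegral (secondQuantization m hφ) (fun p => annihilation m p)
      (fun p Ψ => φ p • annihilation m p Ψ) :=
  isOperatorIntegral_of_single (B := fun p => φ p • annihilation m p)
    (fun Φ Ψ => integrable_inner_of_memLp ((rapidDecay_annihilation Φ).memLp 2 volume)
      (((rapidDecay_annihilation Ψ).smul hφ).memLp 2 volume))
    (fun _ _ => inner_secondQuantization_single hφ)

end OperatorIntegrals

/-! ### Density of the domain -/

section Density

variable {n k : ℕ}

/-- Relabelling the arguments of a Schwartz function of `k` momenta. -/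
def permSchwartz (σ : Equiv.Perm (Fin k)) :
    𝓢(Fin k → Space n, ℂ) →L[ℂ] 𝓢(Fin k → Space n, ℂ) :=
  SchwartzMap.compCLMOfContinuousLinearEquiv ℂ
    (ContinuousLinearEquiv.piCongrLeft ℝ (fun _ : Fin k => Space n) σ).symm

theorem permSchwartz_apply (σ : Equiv.Perm (Fin k)) (f : 𝓢(Fin k → Space n, ℂ))
    (q : Fin k → Space n) : permSchwartz σ f q = f (q ∘ σ) :=
  rfl

/-- The sum over all permutations of the arguments of a Schwartz function, not divided by `k!`. -/
def symmetrize (f : 𝓢(Fin k → Space n, ℂ)) : symSchwartz n k :=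
  ⟨∑ σ : Equiv.Perm (Fin k), permSchwartz σ f, fun τ q => by
    simp only [sum_apply, permSchwartz_apply]
    exact Fintype.sum_equiv (Equiv.mulLeft τ) _ _ fun σ => rfl⟩

variable {m : ℝ} [hm : Fact (0 < m)]

instance instIsLocallyFiniteMassShell : IsLocallyFiniteMeasure (massShellMeasure n m) := by
  have h_cont := continuous_energy (n := n) m
  refine IsLocallyFiniteMeasure.withDensity_ofReal ?_
  exact continuous_const.div (by fun_prop) fun p => (mul_pos two_pos (energy_pos hm.out p)).ne'

theorem toLp_permSchwartz (σ : Equiv.Perm (Fin k)) (f : 𝓢(Fin k → Space n, ℂ)) :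
    (permSchwartz σ f).toLp 2 (kMeasure n m k) =
      Lp.compMeasurePreservingₗᵢ ℂ _ (measurePreserving_perm n m k σ)
        (f.toLp 2 (kMeasure n m k)) :=
  (Lp.toLp_compMeasurePreserving (f.memLp 2 (kMeasure n m k))
    (measurePreserving_perm n m k σ)).symm

theorem inner_toKParticle_symmetrize (f : 𝓢(Fin k → Space n, ℂ)) (v : kParticleSpace n m k) :
    inner ℂ (toKParticle n m k (symmetrize f)) v =
      (Nat.factorial k : ℂ) * inner ℂ (f.toLp 2 (kMeasure n m k)) v.1 := by
  have h_sum : (symmetrize f).1.toLp 2 (kMeasure n m k) =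
      ∑ σ : Equiv.Perm (Fin k), (permSchwartz σ f).toLp 2 (kMeasure n m k) :=
    map_sum (SchwartzMap.toLpCLM ℂ ℂ 2 (kMeasure n m k)) _ _
  have h_perm : ∀ σ : Equiv.Perm (Fin k),
      inner ℂ ((permSchwartz σ f).toLp 2 (kMeasure n m k)) v.1 =
        inner ℂ (f.toLp 2 (kMeasure n m k)) v.1 := fun σ => by
    rw [toLp_permSchwartz]
    nth_rewrite 1 [← v.2 σ]
    exact LinearIsometry.inner_map_map _ _ _
  rw [Submodule.coe_inner, coe_toKParticle, h_sum, sum_inner]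
  simp only [h_perm, Finset.sum_const, Finset.card_univ, Fintype.card_perm, Fintype.card_fin,
    nsmul_eq_mul]

theorem eq_zero_of_inner_toFock {v : lp (fun k : ℕ => kParticleSpace n m k) 2}
    (h : ∀ Φ : Dom n, inner ℂ (toFock m Φ) (show Fock n m from v) = 0) : v = 0 := by
  refine Subtype.ext (funext fun k => Subtype.ext ?_)
  have h_dense := SchwartzMap.denseRange_toLpCLM (F := ℂ) (p := 2) (μ := kMeasure n m k)
    ENNReal.ofNat_ne_top
  refine h_dense.eq_zero_of_inner_right ℂ fun f => ?_
  have h_inner := h (DFinsupp.single k (symmetrize f))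
  rw [inner_toFock_single_left, inner_toKParticle_symmetrize] at h_inner
  exact (mul_eq_zero.1 h_inner).resolve_left (by exact_mod_cast k.factorial_ne_zero)

theorem eq_of_inner_toFock {v w : Fock n m}
    (h : ∀ Φ : Dom n, inner ℂ (toFock m Φ) v = inner ℂ (toFock m Φ) w) : v = w :=
  sub_eq_zero.1 <| eq_zero_of_inner_toFock fun Φ => by
    change inner ℂ (toFock m Φ) (v - w) = 0
    rw [inner_sub_right, h, sub_self]

theorem eq_of_isOperatorIntegral {T T' : Dom n →ₗ[ℂ] Fock n m}
    {A B : Space n → Dom n → Fock n m} (hT : IsOperatorIntegral T A B)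
    (hT' : IsOperatorIntegral T' A B) : T = T' :=
  LinearMap.ext fun Ψ => eq_of_inner_toFock fun Φ => (hT Φ Ψ).2.trans (hT' Φ Ψ).2.symm

end Density

/-! ### The operators in coordinate space -/

section CoordinateSpace

variable {n : ℕ} {m : ℝ}

theorem spatialPairing_eq (p x : Space n) : spatialPairing m p x = -inner ℝ p x := by
  simp only [spatialPairing, covMomentum, Fin.cons_succ, PiLp.inner_apply, RCLike.inner_apply,
    conj_trivial, ← Finset.sum_neg_distrib, neg_mul, mul_comm]

variable [hm : Fact (0 < m)]

theorem fourierIntegrand_eq (x : Space n) (Ψ : Dom n) (p : Space n) :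
    fourierIntegrand m x Ψ p =
      Complex.exp (Complex.I * (inner ℝ p x : ℝ)) • annihilation m p Ψ := by
  rw [fourierIntegrand, spatialPairing_eq, Complex.ofReal_neg, neg_mul_neg]

theorem integrable_fourierIntegrand (x : Space n) (Ψ : Dom n) :
    Integrable (fourierIntegrand m x Ψ) := by
  simp only [funext (fourierIntegrand_eq x Ψ)]
  exact integrable_planeWave_smul ((rapidDecay_annihilation Ψ).integrable volume) x

theorem coordAnnihilation_eq_waveTransform (x : Space n) (Ψ : Dom n) :
    coordAnnihilation m x Ψ = waveTransform (fun p => annihilation m p Ψ) x := by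
  simp only [coordAnnihilation, waveTransform, fourierIntegrand_eq, finrank_euclideanSpace_fin]

theorem differentiable_coordAnnihilation (Ψ : Dom n) :
    Differentiable ℝ fun x : Space n => coordAnnihilation m x Ψ := by
  have h_decay := rapidDecay_annihilation (m := m) Ψ
  simp only [coordAnnihilation_eq_waveTransform]
  exact fun x => (hasFDerivAt_waveTransform (h_decay.integrable volume)
    (h_decay.norm_mul_norm.integrable volume) x).differentiableAt

theorem I_smul_partialDeriv_coordAnnihilation (j : Fin n) (Ψ : Dom n) (x : Space n) :
    Complex.I • partialDeriv j (fun y => coordAnnihilation m y Ψ) x =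
      waveTransform (fun p => (covMomentum m p j.succ : ℂ) • annihilation m p Ψ) x := by
  have h_decay := rapidDecay_annihilation (m := m) Ψ
  have h_symbol : ∀ p : Space n,
      Complex.I * (Complex.I * (inner ℝ p (EuclideanSpace.single j 1) : ℝ)) =
        (covMomentum m p j.succ : ℂ) := fun p => by
    rw [← mul_assoc, Complex.I_mul_I, EuclideanSpace.inner_single_right]
    simp [covMomentum]
  simp only [coordAnnihilation_eq_waveTransform, partialDeriv]
  rw [fderiv_waveTransform_apply (h_decay.integrable volume)
    (h_decay.norm_mul_norm.integrable volume), ← waveTransform_const_smul]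
  simp only [smul_smul, h_symbol]

theorem isOperatorIntegral_waveTransform {φ : Space n → ℂ} (hφ : φ.HasTemperateGrowth) :
    IsOperatorIntegral (secondQuantization m hφ) (coordAnnihilation m)
      (fun x Ψ => waveTransform (fun p => φ p • annihilation m p Ψ) x) := by
  intro Φ Ψ
  have h_left := rapidDecay_annihilation (m := m) Φ
  have h_right := (rapidDecay_annihilation (m := m) Ψ).smul hφ
  simp only [coordAnnihilation_eq_waveTransform]
  refine ⟨integrable_inner_waveTransform (h_left.integrable volume) (h_left.memLp 2 volume)
    (h_right.integrable volume) (h_right.memLp 2 volume), ?_⟩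
  rw [integral_inner_waveTransform (h_left.integrable volume) (h_left.memLp 2 volume)
    (h_right.integrable volume) (h_right.memLp 2 volume)]
  exact (isOperatorIntegral_secondQuantization hφ Φ Ψ).2

variable (m) in
/-- The four-momentum `P_μ`, the second quantization of multiplication by `p_μ`. -/
def momentumOperator (μ : Fin (n + 1)) : Dom n →ₗ[ℂ] Fock n m :=
  secondQuantization m (hasTemperateGrowth_ofReal_covMomentum hm.out μ)

theorem isMomentumOperator_iff (μ : Fin (n + 1)) (T : Dom n →ₗ[ℂ] Fock n m) :
    IsMomentumOperator μ T ↔ T = momentumOperator m μ := by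
  have h_momentum : IsMomentumOperator μ (momentumOperator (n := n) m μ) :=
    isOperatorIntegral_secondQuantization _
  exact ⟨fun hT => eq_of_isOperatorIntegral hT h_momentum, fun hT => hT ▸ h_momentum⟩

theorem hasConvolution_coordAnnihilation [Nontrivial (Space n)] (x : Space n) (Ψ : Dom n) :
    HasConvolution (omegaTilde m) (fun y => coordAnnihilation m y Ψ) x
      (waveTransform (fun p => (covMomentum m p 0 : ℂ) • annihilation m p Ψ) x) := by
  have h_decay := rapidDecay_annihilation (m := m) Ψ
  have h_energy := h_decay.smul (hasTemperateGrowth_ofReal_covMomentum hm.out 0)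
  simp only [coordAnnihilation_eq_waveTransform]
  exact hasConvolution_omegaTilde hm.out (h_decay.integrable volume) (h_energy.integrable volume) x

theorem isOperatorIntegral_partialDeriv (j : Fin n) :
    IsOperatorIntegral (momentumOperator m j.succ) (coordAnnihilation m)
      (fun x Ψ => Complex.I • partialDeriv j (fun y => coordAnnihilation m y Ψ) x) := by
  simp only [I_smul_partialDeriv_coordAnnihilation]
  exact isOperatorIntegral_waveTransform _

end CoordinateSpace

end ScalarFock

end

theorem mainTheorem2 (n : ℕ) (hn : 1 ≤ n) (m : ℝ) [Fact (0 < m)] :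
    -- the coordinate space operators `ã(x)` are well defined and differentiable in `x`
    (∀ (x : Space n) (Ψ : Dom n), Integrable (fourierIntegrand m x Ψ)) ∧
    (∀ Ψ : Dom n, Differentiable ℝ (fun x : Space n => coordAnnihilation m x Ψ)) ∧
    ∃ P : Fin (n + 1) → (Dom n →ₗ[ℂ] Fock n m),
      -- `P μ` is the unique operator `∫ dⁿp p_μ a*(p) a(p)`
      (∀ (μ : Fin (n + 1)) (T : Dom n →ₗ[ℂ] Fock n m), IsMomentumOperator μ T ↔ T = P μ) ∧
      -- `P_0 = ∫ dⁿx ã*(x) (ω̃ ∗ ã)(x)`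
      (∃ conv : Space n → Dom n → Fock n m,
        (∀ (x : Space n) (Ψ : Dom n),
          HasConvolution (omegaTilde m) (fun y => coordAnnihilation m y Ψ) x (conv x Ψ)) ∧
        IsOperatorIntegral (P 0) (coordAnnihilation m) conv) ∧
      -- `P_j = i ∫ dⁿx ã*(x) ∂_j ã(x)`
      (∀ j : Fin n,
        IsOperatorIntegral (P j.succ)
          (coordAnnihilation m)
          (fun x Ψ => Complex.I • partialDeriv j (fun y => coordAnnihilation m y Ψ) x)) := by
  have : Nonempty (Fin n) := ⟨⟨0, hn⟩⟩
  refine ⟨integrable_fourierIntegrand, differentiable_coordAnnihilation, momentumOperator m,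
    isMomentumOperator_iff, ⟨_, hasConvolution_coordAnnihilation, ?_⟩,
    isOperatorIntegral_partialDeriv⟩
  exact isOperatorIntegral_waveTransform _
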